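/- Call a function $G:[0,\infty)\to[0,\infty)$ moderate if it is nondecreasing, $G(t)\to\infty$ as $t\to\infty$, and $\limsup_{t\to\infty}G(2t)/G(t)<\infty$ (if $G>0$ on $[0,\infty)$, the last condition says that $G(2t)/G(t)$ is bounded on $[0,\infty)$). For real random variables $(Y_n)_{n\ge1}$ on a probability space, $x\in\mathbb R$ and $a>0$, let $L_a^x:=\sup\bigl(\{0\}\cup\{n\ge1:|Y_n-x|\ge a\}\bigr)\in\mathbb N\cup\{\infty\}$, and put $G(\infty):=\infty$ for $G$ nondecreasing and unbounded. The sequence $(Y_n)$ is said to $G$-converge to $x$ if $E[G(L_a^x)]<\infty$ for every $a>0$, and to $G$-converge if it $G$-converges to some $x\in\mathbb R$. **Theorem.** Let $X,X_1,X_2,\dots$ be identically distributed real random variables on a probability space, with $X_1,X_2,\dots$ independent; put $S_n:=X_1+\cdots+X_n$, and let $L_a^x$ be defined with $Y_n=S_n/n$. 1. Let $G$ be moderate. Then $S_n/n$ $G$-converges if and only if $|X|\,G(|X|)$ is integrable. 2. Let $G$ be moderate, and let $X$ be integrable with $E[X]=0$. Then the following are equivalent: (a) $|X|\,G(|X|)$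 is integrable; (b) for every $a>0$, $\sum_{n\ge1}n^{-1}G(n)\,P[|S_n/n|\ge a]<\infty$; (c) for every $a>0$, $G(L_a^0)$ is integrable. 3. Let $G:[0,\infty)\to[0,\infty)$ be nondecreasing, unbounded and not moderate. Then (a) and (c) are not equivalent: there is an i.i.d. sequence with integrable centered law for which exactly one of (a) and (c) holds. -/

import Mathlib

open MeasureTheory ProbabilityTheory Filter Set
open scoped ENNReal

/-- `G`, considered on `[0, ∞)`, is a moderate function: nonnegative, nondecreasing, tending to
infinity, and with `G (2 t) / G t` bounded at infinity. Functions that vanish near `0`, such as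
`t ^ r`, are included. For a function that is positive on `[0, ∞)` the last
condition says that `G (2 t) / G t` is bounded on `[0, ∞)`, see `isModerate_iff_of_pos`. -/
structure IsModerate (G : ℝ → ℝ) : Prop where
  nonneg : ∀ t, 0 ≤ t → 0 ≤ G t
  mono : MonotoneOn G (Ici 0)
  tendsto : Tendsto G atTop atTop
  doubling : ∃ c : ℝ, ∀ᶠ t in atTop, G (2 * t) ≤ c * G t

theorem isModerate_iff_of_pos {G : ℝ → ℝ} (hG : ∀ t, 0 ≤ t → 0 < G t) :
    IsModerate G ↔ MonotoneOn G (Ici 0) ∧ Tendsto G atTop atTop ∧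
      ∃ c : ℝ, ∀ t, 0 ≤ t → G (2 * t) / G t ≤ c := by
  constructor
  · intro h
    refine ⟨h.mono, h.tendsto, ?_⟩
    obtain ⟨c, hc⟩ := h.doubling
    obtain ⟨T, hT⟩ := eventually_atTop.1 hc
    refine ⟨max c (G (2 * max T 0) / G 0), fun t ht => ?_⟩
    rcases le_total T t with h1 | h1
    · exact le_max_of_le_left ((div_le_iff₀ (hG t ht)).2 (hT t h1))
    · refine le_max_of_le_right ?_
      have h2 : t ≤ max T 0 := h1.trans (le_max_left _ _)
      have h3 : (0 : ℝ) ≤ max T 0 := le_max_right _ _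
      have h4 : G (2 * t) ≤ G (2 * max T 0) :=
        h.mono (mem_Ici.2 (by positivity)) (mem_Ici.2 (by positivity)) (by linarith)
      have h5 : G 0 ≤ G t := h.mono self_mem_Ici (mem_Ici.2 ht) ht
      exact div_le_div₀ (hG _ (by positivity)).le h4 (hG 0 le_rfl) h5
  · rintro ⟨h1, h2, c, hc⟩
    refine ⟨fun t ht => (hG t ht).le, h1, h2, c, ?_⟩
    filter_upwards [eventually_ge_atTop 0] with t ht
    exact (div_le_iff₀ (hG t ht)).1 (hc t ht)

/-- `X 0, X 1, …` are independent identically distributed real random variables. The generic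
variable of the sequence is `X 0`. -/
structure IsIID {Ω : Type*} [MeasurableSpace Ω] (μ : Measure Ω) (X : ℕ → Ω → ℝ) : Prop where
  measurable : ∀ n, Measurable (X n)
  indep : iIndepFun X μ
  ident : ∀ n, IdentDistrib (X n) (X 0) μ μ

/-- The mean `S_n / n` of the first `n` variables (only used for `n ≥ 1`). -/
noncomputable def cesaroMean {Ω : Type*} (X : ℕ → Ω → ℝ) (n : ℕ) (ω : Ω) : ℝ :=
  (∑ i ∈ Finset.range n, X i ω) / n

/-- The last time `L_a^x = sup ({0} ∪ {n ≥ 1 ; |Y_n - x| ≥ a})`, with values in `ℕ ∪ {∞}`. -/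
noncomputable def lastTime {Ω : Type*} (Y : ℕ → Ω → ℝ) (x a : ℝ) (ω : Ω) : ℕ∞ :=
  sSup ({0} ∪ (fun n : ℕ => (n : ℕ∞)) '' {n : ℕ | 1 ≤ n ∧ a ≤ |Y n ω - x|})

/-- The extension of a nonnegative `G` to `ℕ ∪ {∞}`, with the value `∞` at `∞`. -/
noncomputable def extendTop (G : ℝ → ℝ) : ℕ∞ → ℝ≥0∞
  | ⊤ => ⊤
  | (n : ℕ) => ENNReal.ofReal (G n)

/-- `G (L_a^x)` is integrable for every `a > 0`, that is, `(Y_n)` `G`-converges to `x`. -/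
def GConvergesTo {Ω : Type*} [MeasurableSpace Ω] (μ : Measure Ω) (G : ℝ → ℝ)
    (Y : ℕ → Ω → ℝ) (x : ℝ) : Prop :=
  ∀ a : ℝ, 0 < a → ∫⁻ ω, extendTop G (lastTime Y x a ω) ∂μ < ∞

/-- The series `∑_{n ≥ 1} n⁻¹ G(n) P[|Y_n| ≥ a]` as an element of `[0, ∞]`. -/
noncomputable def deviationSeries {Ω : Type*} [MeasurableSpace Ω] (μ : Measure Ω) (G : ℝ → ℝ)
    (Y : ℕ → Ω → ℝ) (a : ℝ) : ℝ≥0∞ :=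
  ∑' n : ℕ, ENNReal.ofReal (((n + 1 : ℕ) : ℝ)⁻¹ * G ((n + 1 : ℕ) : ℝ)) *
    μ {ω | a ≤ |Y (n + 1) ω|}

/-! From (c) to (a). Since `X k` is the difference of `(k+1) Y_{k+1}` and `k Y_k`, where `Y_n =
S_n/n`, a large value of `|X k - x|` forces one of two consecutive means away from `x`; so the last
time is at least `k` on the event `|X k - x| ≥ 2a(k+1)`. These events are independent. Integrability
of `G(L)` makes their probabilities summable by Borel–Cantelli, and far out in the sequence each
event keeps at least half its mass when the earlier ones are removed. The pieces left are disjoint,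
so `∑ G(k) P[|X - x| ≥ 2a(k+1)]` is finite (`tsum_mul_measure_lt_top_of_le_lintegral`). As `a` is
arbitrary, `|X| G(b|X|)` is integrable for every `b ≥ 0`, and no doubling condition enters.

From (a) to (b). Truncate at level `n`. A Chernoff bound for the truncated sum, tuned to give the
`K`-th power of a small variance, yields `P[|S_n| ≥ 4Kn] ≤ 2 (n P[|X| ≥ n] + C E[|X| (|X|/n)^K; |X|
≤ n])` for large `n`. Doubling gives `G` at most polynomial growth of some order `r`; with `K = r +
1` both terms, weighted by `G(n)/n`, sum to a multiple of `E[|X| G(|X|)]` up to finite constants.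
Rescaling `X` replaces `4K` by an arbitrary `a`.

From (b) to (c). If the mean deviates at time `l`, then for each `m` in `[l, 2l)` the maximum of
`|S_n|` over `n ≤ m` is of order `m`; the weights `G(m)/m` over this block add up to at least
`G(l)/2`. Ottaviani's inequality replaces the maximum by `|S_m|`.

Part 1 follows by centering. For part 3, a non-moderate `G` admits a symmetric discrete law with
`|X| G(|X|)` integrable but `|X| G(2|X|)` not; then (a) holds, and (c) fails by the case `b = 2`
above. -/

/-- The extended nonnegative version of `G`, constant on `(-∞, 0]`. -/
noncomputable def ennLift (G : ℝ → ℝ) (t : ℝ) : ℝ≥0∞ := ENNReal.ofReal (G (max t 0))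

/-! ### Values of `G` in `[0, ∞]` and at the last time -/

section Lift

variable {G : ℝ → ℝ}

theorem ennLift_of_nonneg {t : ℝ} (ht : 0 ≤ t) : ennLift G t = ENNReal.ofReal (G t) := by
  rw [ennLift, max_eq_left ht]

theorem ennLift_ne_top (t : ℝ) : ennLift G t ≠ ∞ := ENNReal.ofReal_ne_top

theorem monotone_ennLift (hG : MonotoneOn G (Ici 0)) : Monotone (ennLift G) := fun _ _ h =>
  ENNReal.ofReal_le_ofReal
    (hG (mem_Ici.2 (le_max_right _ _)) (mem_Ici.2 (le_max_right _ _)) (max_le_max_right 0 h))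

theorem tendsto_ennLift (hG : Tendsto G atTop atTop) :
    Tendsto (ennLift G) atTop (nhds ∞) := by
  refine (ENNReal.tendsto_ofReal_atTop.comp hG).congr' ?_
  filter_upwards [eventually_ge_atTop 0] with t ht
  rw [Function.comp_apply, ennLift_of_nonneg ht]

theorem integrable_abs_mul_iff {Ω : Type*} [MeasurableSpace Ω] {μ : Measure Ω} {Y : Ω → ℝ}
    (hG0 : ∀ t, 0 ≤ t → 0 ≤ G t) (hG : MonotoneOn G (Ici 0)) (hY : Measurable Y) :
    Integrable (fun ω => |Y ω| * G |Y ω|) μ ↔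
      ∫⁻ ω, ENNReal.ofReal |Y ω| * ennLift G |Y ω| ∂μ < ∞ := by
  have hm : Monotone fun t => G (max t 0) := fun a b h =>
    hG (mem_Ici.2 (le_max_right _ _)) (mem_Ici.2 (le_max_right _ _)) (max_le_max_right 0 h)
  have hmeas : Measurable fun ω => |Y ω| * G |Y ω| := by
    have : (fun ω => |Y ω| * G |Y ω|) = fun ω => |Y ω| * (fun t => G (max t 0)) |Y ω| := by
      funext ω
      simp
    rw [this]
    exact hY.abs.mul (hm.measurable.comp hY.abs)
  have h0 : ∀ ω, 0 ≤ |Y ω| * G |Y ω| := fun ω => mul_nonneg (abs_nonneg _) (hG0 _ (abs_nonneg _))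
  rw [Integrable, and_iff_right hmeas.aestronglyMeasurable,
    hasFiniteIntegral_iff_ofReal (Eventually.of_forall h0)]
  simp only [ENNReal.ofReal_mul (abs_nonneg _), ennLift_of_nonneg (abs_nonneg _)]

theorem ennLift_le_extendTop (hG : MonotoneOn G (Ici 0)) {k : ℕ} {L : ℕ∞} (h : (k : ℕ∞) ≤ L) :
    ennLift G k ≤ extendTop G L := by
  cases L with
  | top => exact le_top
  | coe n =>
    rw [ennLift_of_nonneg (Nat.cast_nonneg k)]
    exact ENNReal.ofReal_le_ofReal (hG (mem_Ici.2 (Nat.cast_nonneg k))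
      (mem_Ici.2 (Nat.cast_nonneg n)) (Nat.cast_le.2 (Nat.cast_le.1 h)))

theorem le_lastTime {Ω : Type*} {Y : ℕ → Ω → ℝ} {x a : ℝ} {ω : Ω} {n : ℕ} (hn : 1 ≤ n)
    (h : a ≤ |Y n ω - x|) : (n : ℕ∞) ≤ lastTime Y x a ω :=
  le_sSup (Or.inr ⟨n, ⟨hn, h⟩, rfl⟩)

/-- A finite supremum of naturals is attained, so the bound at deviation times applies to it. An
infinite last time means arbitrarily late deviations, and `G → ∞` then forces `C = ∞`. -/
theorem extendTop_lastTime_le (hG : Tendsto G atTop atTop) {Ω : Type*} {Y : ℕ → Ω → ℝ}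
    {x a : ℝ} {ω : Ω} {C : ℝ≥0∞} (h0 : ennLift G 0 ≤ C)
    (h : ∀ n : ℕ, 1 ≤ n → a ≤ |Y n ω - x| → ennLift G n ≤ C) :
    extendTop G (lastTime Y x a ω) ≤ C := by
  have hmem : ∀ n : ℕ, (n : ℕ∞) ∈
      ({0} ∪ (fun n : ℕ => (n : ℕ∞)) '' {n : ℕ | 1 ≤ n ∧ a ≤ |Y n ω - x|} : Set ℕ∞) →
      ennLift G n ≤ C := by
    rintro n (h1 | ⟨m, ⟨h1, h2⟩, h3⟩)
    · have : n = 0 := by simpa using h1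
      simpa [this] using h0
    · obtain rfl : m = n := Nat.cast_injective h3
      exact h m h1 h2
  by_cases hL : lastTime Y x a ω < ⊤
  · obtain ⟨n, hn⟩ := ENat.ne_top_iff_exists.1 hL.ne
    have : Nonempty ({0} ∪ (fun n : ℕ => (n : ℕ∞)) '' {n : ℕ | 1 ≤ n ∧ a ≤ |Y n ω - x|} :
      Set ℕ∞) := ⟨⟨0, Or.inl rfl⟩⟩
    have hin := ENat.sSup_mem_of_nonempty_of_lt_top hL
    change lastTime Y x a ω ∈ _ at hin
    rw [← hn] at hin ⊢
    have := hmem n hin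
    rwa [ennLift_of_nonneg (Nat.cast_nonneg n)] at this
  · rw [not_lt, top_le_iff] at hL
    rw [hL]
    refine le_of_tendsto_of_frequently
      ((tendsto_ennLift hG).comp tendsto_natCast_atTop_atTop) (frequently_atTop.2 fun N => ?_)
    have hN : (N : ℕ∞) < lastTime Y x a ω := hL ▸ ENat.natCast_lt_top N
    obtain ⟨m, hm, hNm⟩ := lt_sSup_iff.1 hN
    obtain ⟨n, rfl⟩ : ∃ n : ℕ, (n : ℕ∞) = m := by
      rcases hm with h1 | ⟨n, -, h1⟩
      exacts [⟨0, by simpa using h1.symm⟩, ⟨n, h1⟩]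
    exact ⟨n, (Nat.cast_lt.1 hNm).le, hmem n hm⟩

end Lift

theorem ENNReal.tsum_lt_top_of_tail {f : ℕ → ℝ≥0∞} (k : ℕ) (hf : ∀ n, f n ≠ ∞)
    (h : ∑' n, f (n + k) < ∞) : ∑' n, f n < ∞ := by
  rw [← ENNReal.summable.sum_add_tsum_nat_add' (f := f) (k := k)]
  exact ENNReal.add_lt_top.2 ⟨ENNReal.sum_lt_top.2 fun n _ => (hf n).lt_top, h⟩

/-! ### Integrals bounded below on independent events -/

section IndependentEvents

variable {Ω : Type*} [MeasurableSpace Ω] {μ : Measure Ω}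

/-- If the series diverged, almost every point would lie in infinitely many `A k` by the second
Borel–Cantelli lemma, and `f` would be infinite there. -/
theorem tsum_measure_ne_top_of_le_lintegral {A : ℕ → Set Ω} (hAm : ∀ k, MeasurableSet (A k))
    (hA : iIndepSet A μ) {h : ℕ → ℝ≥0∞} (hh : Tendsto h atTop (nhds ∞)) {f : Ω → ℝ≥0∞}
    (hf : ∀ k, ∀ ω ∈ A k, h k ≤ f ω) (hint : ∫⁻ ω, f ω ∂μ < ∞) : ∑' k, μ (A k) ≠ ∞ := by
  intro htop
  have h1 := measure_limsup_eq_one hAm hA htop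
  have h2 : ∫⁻ _ in limsup A atTop, ∞ ∂μ ≤ ∫⁻ ω in limsup A atTop, f ω ∂μ := by
    refine setLIntegral_mono' (MeasurableSet.measurableSet_limsup hAm) fun ω hω => ?_
    rw [mem_limsup_iff_frequently_mem] at hω
    exact le_of_tendsto_of_frequently hh (hω.mono fun k hk => hf k ω hk)
  rw [setLIntegral_const, h1, mul_one] at h2
  exact absurd (h2.trans (setLIntegral_le_lintegral _ _)) (not_le.2 hint)

/-- By pairwise independence the part of `B k` covered by earlier events has measure at most `μ (B
k) * ∑ μ (B j)`, hence at most half of `μ (B k)`. -/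
theorem half_measure_le_measure_diff_biUnion [IsProbabilityMeasure μ] {B : ℕ → Set Ω}
    (hB : Pairwise fun i j => μ (B i ∩ B j) = μ (B i) * μ (B j))
    (hsum : ∑' k, μ (B k) ≤ 1 / 2) (k : ℕ) :
    μ (B k) / 2 ≤ μ (B k \ ⋃ j ∈ Finset.range k, B j) := by
  have h1 : μ (B k) ≤ μ (B k \ ⋃ j ∈ Finset.range k, B j) + μ (B k) / 2 := by
    calc μ (B k) ≤ μ ((B k \ ⋃ j ∈ Finset.range k, B j) ∪ ⋃ j ∈ Finset.range k, B k ∩ B j) := by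
          refine measure_mono fun ω hω => ?_
          by_cases h : ω ∈ ⋃ j ∈ Finset.range k, B j
          · right
            simp only [mem_iUnion] at h ⊢
            obtain ⟨j, hj, h⟩ := h
            exact ⟨j, hj, hω, h⟩
          · exact Or.inl ⟨hω, h⟩
      _ ≤ _ := measure_union_le _ _
      _ ≤ _ := by
          gcongr
          calc μ (⋃ j ∈ Finset.range k, B k ∩ B j)
              ≤ ∑ j ∈ Finset.range k, μ (B k ∩ B j) := measure_biUnion_finset_le _ _
            _ = ∑ j ∈ Finset.range k, μ (B k) * μ (B j) :=
                Finset.sum_congr rfl fun j hj => hB (Finset.mem_range.1 hj).ne'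
            _ = μ (B k) * ∑ j ∈ Finset.range k, μ (B j) := (Finset.mul_sum _ _ _).symm
            _ ≤ μ (B k) * (1 / 2) := by
                gcongr
                exact (ENNReal.sum_le_tsum _).trans hsum
            _ = μ (B k) / 2 := by rw [one_div, ENNReal.div_eq_inv_mul, mul_comm]
  nth_rewrite 1 [← ENNReal.add_halves (μ (B k))] at h1
  exact (ENNReal.add_le_add_iff_right
    (ENNReal.div_ne_top (measure_ne_top μ _) two_ne_zero)).1 h1

/-- Drop finitely many events so that the remaining probabilities sum to at most `1/2`. The
first-occurrence sets `F k` are then disjoint, carry half the mass of the events, and satisfy `f ≥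
h` on them; integrating `f` over their union costs only a factor 2. -/
theorem tsum_mul_measure_lt_top_of_le_lintegral {A : ℕ → Set Ω} (hAm : ∀ k, MeasurableSet (A k))
    (hA : iIndepSet A μ) {h : ℕ → ℝ≥0∞} (hh : Tendsto h atTop (nhds ∞)) (hfin : ∀ k, h k ≠ ∞)
    {f : Ω → ℝ≥0∞} (hf : ∀ k, ∀ ω ∈ A k, h k ≤ f ω) (hint : ∫⁻ ω, f ω ∂μ < ∞) :
    ∑' k, h k * μ (A k) < ∞ := by
  have : IsProbabilityMeasure μ := hA.isProbabilityMeasure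
  have hsum := tsum_measure_ne_top_of_le_lintegral hAm hA hh hf hint
  obtain ⟨k₀, hk₀⟩ := ((ENNReal.tendsto_sum_nat_add _ hsum).eventually
    (ge_mem_nhds (show (0 : ℝ≥0∞) < 1 / 2 by simp))).exists
  refine ENNReal.tsum_lt_top_of_tail k₀
    (fun n => ENNReal.mul_ne_top (hfin n) (measure_ne_top μ _)) ?_
  set B : ℕ → Set Ω := fun k => A (k + k₀) with hB
  have hBm : ∀ k, MeasurableSet (B k) := fun k => hAm _
  set F : ℕ → Set Ω := fun k => B k \ ⋃ j ∈ Finset.range k, B j with hF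
  have hFm : ∀ k, MeasurableSet (F k) := fun k =>
    (hBm k).diff (Finset.measurableSet_biUnion _ fun j _ => hBm j)
  have hFB : ∀ k, F k ⊆ B k := fun k => sdiff_subset
  have hlt : ∀ i j, i < j → Disjoint (F i) (F j) := fun i j hij =>
    disjoint_left.2 fun ω h1 h2 => h2.2
      (mem_biUnion (Finset.mem_coe.2 (Finset.mem_range.2 hij)) (hFB i h1))
  have hdisj : Pairwise (Function.onFun Disjoint F) := fun i j hij =>
    (lt_or_gt_of_ne hij).elim (hlt i j) fun h => (hlt j i h).symm
  have hpair : Pairwise fun i j => μ (B i ∩ B j) = μ (B i) * μ (B j) := fun i j hij => by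
    have h := (iIndepSet_iff_meas_biInter hAm).1 hA {i + k₀, j + k₀}
    rw [Finset.prod_pair (by simpa using hij)] at h
    simpa using h
  have key : ∑' k, h (k + k₀) * μ (B k) ≤ 2 * ∫⁻ ω, f ω ∂μ := by
    calc ∑' k, h (k + k₀) * μ (B k) ≤ ∑' k, 2 * ∫⁻ ω in F k, f ω ∂μ := by
          refine ENNReal.tsum_le_tsum fun k => ?_
          have h1 : h (k + k₀) * μ (F k) ≤ ∫⁻ ω in F k, f ω ∂μ := by
            rw [← setLIntegral_const]
            exact setLIntegral_mono' (hFm k) fun ω hω => hf _ ω (hFB k hω)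
          have h2 : μ (B k) ≤ 2 * μ (F k) := by
            have := half_measure_le_measure_diff_biUnion hpair hk₀ k
            rwa [ENNReal.div_le_iff_le_mul (Or.inl two_ne_zero) (Or.inl ENNReal.ofNat_ne_top),
              mul_comm] at this
          calc h (k + k₀) * μ (B k) ≤ h (k + k₀) * (2 * μ (F k)) := by gcongr
            _ = 2 * (h (k + k₀) * μ (F k)) := by ring
            _ ≤ _ := by gcongr
      _ = 2 * ∫⁻ ω in ⋃ k, F k, f ω ∂μ := by
          rw [ENNReal.tsum_mul_left, lintegral_iUnion hFm hdisj]
      _ ≤ _ := by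
          exact mul_le_mul_right (setLIntegral_le_lintegral _ _) _
  exact key.trans_lt (ENNReal.mul_lt_top (by simp) hint)

end IndependentEvents

/-! ### From `G`-convergence to moments -/

section Converse

variable {Ω : Type*} [MeasurableSpace Ω] {μ : Measure Ω} {G : ℝ → ℝ}

/-- If the means at times `k` and `k + 1` were both within `a` of `x`, the increment would satisfy
`|X k - x| < (2k + 1) a`. For `k = 0` only the mean at time 1 is admissible, but the claim is then
trivial. -/
theorem le_lastTime_cesaroMean {Ω : Type*} {X : ℕ → Ω → ℝ} {x a : ℝ} (ha : 0 < a) {k : ℕ} {ω : Ω}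
    (h : 2 * a * (k + 1) ≤ |X k ω - x|) : (k : ℕ∞) ≤ lastTime (cesaroMean X) x a ω := by
  by_cases h1 : a ≤ |cesaroMean X (k + 1) ω - x|
  · exact (Nat.cast_le.2 (Nat.le_succ k)).trans (le_lastTime (Nat.le_add_left 1 k) h1)
  rcases Nat.eq_zero_or_pos k with rfl | hk
  · simp
  refine le_lastTime hk ?_
  by_contra h2
  rw [not_le] at h1 h2
  have hk' : (0 : ℝ) < k := Nat.cast_pos.2 hk
  have e : X k ω - x = (k + 1) * (cesaroMean X (k + 1) ω - x) - k * (cesaroMean X k ω - x) := by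
    have : (k + 1 : ℝ) ≠ 0 := by positivity
    simp only [cesaroMean, Finset.sum_range_succ]
    push_cast
    field_simp
    ring
  have h3 : |X k ω - x| ≤ (k + 1) * |cesaroMean X (k + 1) ω - x| + k * |cesaroMean X k ω - x| := by
    rw [e]
    refine (abs_sub _ _).trans (le_of_eq ?_)
    rw [abs_mul, abs_mul, abs_of_pos hk', abs_of_pos (by positivity)]
  have h4 : (k + 1) * |cesaroMean X (k + 1) ω - x| < (k + 1) * a := by gcongr
  have h5 : (k : ℝ) * |cesaroMean X k ω - x| < k * a := by gcongr
  nlinarith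

theorem tsum_ennLift_mul_measure_lt_top [IsProbabilityMeasure μ] (hG : MonotoneOn G (Ici 0))
    (hGt : Tendsto G atTop atTop) {X : ℕ → Ω → ℝ} (hX : IsIID μ X) {x : ℝ}
    (h : GConvergesTo μ G (cesaroMean X) x) {c : ℝ} (hc : 0 < c) :
    ∑' k : ℕ, ennLift G k * μ {ω | c * (k + 1) ≤ |X 0 ω - x|} < ∞ := by
  have hset : ∀ k : ℕ, MeasurableSet {y : ℝ | c * (k + 1) ≤ |y - x|} := fun k =>
    measurableSet_le measurable_const (by fun_prop)
  set A : ℕ → Set Ω := fun k => {ω | c * (k + 1) ≤ |X k ω - x|} with hA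
  have hAm : ∀ k, MeasurableSet (A k) := fun k => hX.measurable k (hset k)
  have hind : iIndepSet A μ := by
    rw [iIndepSet_iff_meas_biInter hAm]
    intro s
    exact hX.indep.measure_inter_preimage_eq_mul s fun i _ => hset i
  have key := tsum_mul_measure_lt_top_of_le_lintegral hAm hind
    ((tendsto_ennLift hGt).comp tendsto_natCast_atTop_atTop) (fun k => ennLift_ne_top _)
    (f := fun ω => extendTop G (lastTime (cesaroMean X) x (c / 2) ω))
    (fun k ω hω => ennLift_le_extendTop hG
      (le_lastTime_cesaroMean (half_pos hc) (by
        rw [mul_div_cancel₀ _ (two_ne_zero' ℝ)]; exact hω)))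
    (h _ (half_pos hc))
  refine lt_of_eq_of_lt (tsum_congr fun k => ?_) key
  rw [Function.comp_apply]
  congr 1
  exact ((hX.ident k).measure_mem_eq (hset k)).symm

/-- The integers `k` with `b y ≤ k < ⌊(b + 4) y⌋` number at least `4y - 2 ≥ y`, and each contributes
`H k ≥ H (b y)`. The 4 is slack absorbing the two roundings when `y ≥ 1`. -/
theorem mul_le_tsum_indicator {H : ℝ → ℝ≥0∞} (hH : Monotone H) {b y : ℝ} (hb : 0 ≤ b)
    (hy : 1 ≤ y) :
    ENNReal.ofReal y * H (b * y) ≤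
      ∑' k : ℕ, {z : ℝ | (b + 4)⁻¹ * (k + 1) ≤ z}.indicator (fun _ => H k) y := by
  set s := Finset.Ico ⌈b * y⌉₊ ⌊(b + 4) * y⌋₊ with hs
  have hb4 : 0 < b + 4 := by linarith
  have hcard : y ≤ (s.card : ℝ) := by
    rw [hs, Nat.card_Ico]
    have h1 := Nat.ceil_lt_add_one (mul_nonneg hb (zero_le_one.trans hy))
    have h2 := Nat.lt_floor_add_one ((b + 4) * y)
    have h3 : ⌈b * y⌉₊ ≤ ⌊(b + 4) * y⌋₊ := by
      rw [← Nat.cast_le (α := ℝ)]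
      nlinarith
    rw [Nat.cast_sub h3]
    nlinarith
  calc ENNReal.ofReal y * H (b * y) ≤ (s.card : ℝ≥0∞) * H (b * y) := by
        gcongr
        exact ENNReal.ofReal_le_of_le_toReal (by simpa using hcard)
    _ = ∑ _k ∈ s, H (b * y) := by rw [Finset.sum_const, nsmul_eq_mul]
    _ ≤ ∑ k ∈ s, {z : ℝ | (b + 4)⁻¹ * (k + 1) ≤ z}.indicator (fun _ => H k) y := by
        refine Finset.sum_le_sum fun k hk => ?_
        rw [hs, Finset.mem_Ico] at hk
        rw [indicator_of_mem]
        · exact hH (Nat.ceil_le.1 hk.1)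
        · rw [Set.mem_ofPred_eq, inv_mul_le_iff₀ hb4]
          have := (Nat.le_floor_iff (by positivity)).1 (Nat.succ_le_of_lt hk.2)
          exact_mod_cast this
    _ ≤ _ := ENNReal.sum_le_tsum _

theorem lintegral_mul_lt_top_of_tsum {H : ℝ → ℝ≥0∞} (hH : Monotone H) (hfin : ∀ t, H t ≠ ∞)
    [IsProbabilityMeasure μ] {Y : Ω → ℝ} (hY : Measurable Y) {b : ℝ} (hb : 0 ≤ b)
    (h : ∑' k : ℕ, H k * μ {ω | (b + 4)⁻¹ * (k + 1) ≤ Y ω} < ∞) :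
    ∫⁻ ω, ENNReal.ofReal (Y ω) * H (b * Y ω) ∂μ < ∞ := by
  have hm : ∀ k : ℕ, MeasurableSet {z : ℝ | (b + 4)⁻¹ * (k + 1) ≤ z} := fun k => measurableSet_Ici
  have e : ∫⁻ ω, ∑' k : ℕ, {z : ℝ | (b + 4)⁻¹ * (k + 1) ≤ z}.indicator (fun _ => H k) (Y ω) ∂μ =
      ∑' k : ℕ, H k * μ {ω | (b + 4)⁻¹ * (k + 1) ≤ Y ω} := by
    rw [lintegral_tsum fun k : ℕ =>
      (show Measurable fun ω => {z : ℝ | (b + 4)⁻¹ * (k + 1) ≤ z}.indicator (fun _ => H k) (Y ω)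
        from (measurable_const.indicator (hm k)).comp hY).aemeasurable]
    refine tsum_congr fun k => ?_
    exact lintegral_indicator_const (hY (hm k)) (H k)
  calc ∫⁻ ω, ENNReal.ofReal (Y ω) * H (b * Y ω) ∂μ
      ≤ ∫⁻ ω, (H b + ∑' k : ℕ,
          {z : ℝ | (b + 4)⁻¹ * (k + 1) ≤ z}.indicator (fun _ => H k) (Y ω)) ∂μ := by
        refine lintegral_mono fun ω => ?_
        rcases le_total 1 (Y ω) with h1 | h1
        · exact (mul_le_tsum_indicator hH hb h1).trans le_add_self
        · refine le_trans ?_ le_self_add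
          calc ENNReal.ofReal (Y ω) * H (b * Y ω) ≤ 1 * H b := by
                gcongr
                · exact ENNReal.ofReal_le_one.2 h1
                · exact hH (by nlinarith)
            _ = H b := one_mul _
    _ = H b + ∑' k : ℕ, H k * μ {ω | (b + 4)⁻¹ * (k + 1) ≤ Y ω} := by
        rw [lintegral_add_left measurable_const, e, lintegral_const, measure_univ, mul_one]
    _ < ∞ := ENNReal.add_lt_top.2 ⟨(hfin b).lt_top, h⟩

/-- The scale `b` is arbitrary because `G`-convergence concerns every `a > 0`: here the increment
threshold is `c = (b + 4)⁻¹`. -/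
theorem lintegral_abs_sub_mul_lt_top_of_gConvergesTo [IsProbabilityMeasure μ]
    (hG : MonotoneOn G (Ici 0)) (hGt : Tendsto G atTop atTop) {X : ℕ → Ω → ℝ} (hX : IsIID μ X)
    {x : ℝ} (h : GConvergesTo μ G (cesaroMean X) x) {b : ℝ} (hb : 0 ≤ b) :
    ∫⁻ ω, ENNReal.ofReal |X 0 ω - x| * ennLift G (b * |X 0 ω - x|) ∂μ < ∞ :=
  lintegral_mul_lt_top_of_tsum (monotone_ennLift hG) ennLift_ne_top
    (Y := fun ω => |X 0 ω - x|) ((hX.measurable 0).sub_const x).abs hb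
    (tsum_ennLift_mul_measure_lt_top hG hGt hX h (by positivity))

/-- Either `|Y| ≤ 2|x|`, a bounded contribution, or `|Y| ≤ 2|Y - x|`; the shift costs a factor 2
inside `H`. -/
theorem lintegral_abs_mul_lt_top_of_sub {H : ℝ → ℝ≥0∞} (hH : Monotone H) (hfin : ∀ t, H t ≠ ∞)
    [IsProbabilityMeasure μ] {Y : Ω → ℝ} {x b : ℝ} (hb : 0 ≤ b)
    (h : ∫⁻ ω, ENNReal.ofReal |Y ω - x| * H ((2 * b) * |Y ω - x|) ∂μ < ∞) :
    ∫⁻ ω, ENNReal.ofReal |Y ω| * H (b * |Y ω|) ∂μ < ∞ := by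
  calc ∫⁻ ω, ENNReal.ofReal |Y ω| * H (b * |Y ω|) ∂μ
      ≤ ∫⁻ ω, (ENNReal.ofReal (2 * |x|) * H (b * (2 * |x|)) +
          2 * (ENNReal.ofReal |Y ω - x| * H ((2 * b) * |Y ω - x|))) ∂μ := by
        refine lintegral_mono fun ω => ?_
        rcases le_total |Y ω| (2 * |x|) with h1 | h1
        · refine le_trans ?_ le_self_add
          gcongr
          exact hH (by gcongr)
        · refine le_trans ?_ le_add_self
          have h2 : |Y ω| ≤ 2 * |Y ω - x| := by
            have := abs_sub_abs_le_abs_sub (Y ω) x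
            linarith
          rw [← mul_assoc]
          gcongr
          · rw [← ENNReal.ofReal_ofNat, ← ENNReal.ofReal_mul zero_le_two]
            exact ENNReal.ofReal_le_ofReal h2
          · exact hH (by nlinarith)
    _ = ENNReal.ofReal (2 * |x|) * H (b * (2 * |x|)) +
          2 * ∫⁻ ω, ENNReal.ofReal |Y ω - x| * H ((2 * b) * |Y ω - x|) ∂μ := by
        rw [lintegral_add_left measurable_const, lintegral_const_mul' 2 _ (by simp),
          lintegral_const, measure_univ, mul_one]
    _ < ∞ := ENNReal.add_lt_top.2 ⟨ENNReal.mul_lt_top ENNReal.ofReal_lt_top (hfin _).lt_top,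
        ENNReal.mul_lt_top (by simp) h⟩

theorem lintegral_abs_mul_lt_top_of_gConvergesTo [IsProbabilityMeasure μ]
    (hG : MonotoneOn G (Ici 0)) (hGt : Tendsto G atTop atTop) {X : ℕ → Ω → ℝ} (hX : IsIID μ X)
    {x : ℝ} (h : GConvergesTo μ G (cesaroMean X) x) {b : ℝ} (hb : 0 ≤ b) :
    ∫⁻ ω, ENNReal.ofReal |X 0 ω| * ennLift G (b * |X 0 ω|) ∂μ < ∞ :=
  lintegral_abs_mul_lt_top_of_sub (monotone_ennLift hG) ennLift_ne_top hb
    (lintegral_abs_sub_mul_lt_top_of_gConvergesTo hG hGt hX h (by positivity))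

end Converse

/-! ### A maximal inequality for the partial sums -/

section Maximal

variable {Ω : Type*} [MeasurableSpace Ω] {μ : Measure Ω}

/-- The whole path stopped at time `n` is kept, so that a first-passage event at time `n` is a
preimage under it. -/
theorem indepFun_partialSums_increment {X : ℕ → Ω → ℝ} (hX : ∀ n, Measurable (X n))
    (hind : iIndepFun X μ) {n m : ℕ} (hnm : n ≤ m) :
    IndepFun (fun ω (j : ℕ) => ∑ i ∈ Finset.range (min j n), X i ω)
      (fun ω => ∑ i ∈ Finset.range m, X i ω - ∑ i ∈ Finset.range n, X i ω) μ := by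
  have h := hind.indepFun_finset (Finset.range n) (Finset.Ico n m)
    (Finset.disjoint_left.2 fun i h1 h2 => by
      rw [Finset.mem_range] at h1
      exact absurd h1 (not_lt.2 (Finset.mem_Ico.1 h2).1)) hX
  have h1 : Measurable fun (v : Finset.range n → ℝ) (j : ℕ) =>
      ∑ i : Finset.range n, if (i : ℕ) < j then v i else 0 := by
    refine measurable_pi_lambda _ fun j => Finset.measurable_sum _ fun i _ => ?_
    split_ifs
    · exact measurable_pi_apply i
    · exact measurable_const
  have h2 : Measurable fun (v : Finset.Ico n m → ℝ) => ∑ i, v i := by fun_prop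
  convert h.comp h1 h2 using 1
  · funext ω j
    simp only [Function.comp_apply]
    rw [Finset.sum_coe_sort (Finset.range n) fun i => if i < j then X i ω else 0,
      ← Finset.sum_filter]
    refine Finset.sum_congr ?_ fun _ _ => rfl
    ext i
    simp [and_comm]
  · funext ω
    simp only [Function.comp_apply]
    rw [Finset.sum_coe_sort (Finset.Ico n m) fun i => X i ω, Finset.sum_Ico_eq_sub _ hnm]

/-- **Ottaviani's inequality**. -/
theorem measure_exists_partialSum_ge_le {X : ℕ → Ω → ℝ} [IsProbabilityMeasure μ]
    (hX : ∀ n, Measurable (X n)) (hind : iIndepFun X μ) {m : ℕ} {r : ℝ}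
    (h : ∀ n ≤ m, μ {ω | r ≤ |∑ i ∈ Finset.range m, X i ω - ∑ i ∈ Finset.range n, X i ω|} ≤ 1 / 2) :
    μ {ω | ∃ n ≤ m, 2 * r ≤ |∑ i ∈ Finset.range n, X i ω|} ≤
      2 * μ {ω | r ≤ |∑ i ∈ Finset.range m, X i ω|} := by
  set S : ℕ → Ω → ℝ := fun n ω => ∑ i ∈ Finset.range n, X i ω with hS
  have hSm : ∀ n, Measurable (S n) := fun n => Finset.measurable_sum _ fun i _ => hX i
  -- First passage over the level `2r` at time `n`, as a set of paths. Its preimage `F n` is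
  -- independent of the increment `S m - S n`, which is below `r` with probability at least `1/2`,
  -- keeping `|S m| ≥ r`.
  set W : ℕ → Set (ℕ → ℝ) := fun n => {w | 2 * r ≤ |w n|} ∩ ⋂ j ∈ Finset.range n, {w | |w j| < 2 * r}
    with hW
  have hWm : ∀ n, MeasurableSet (W n) := fun n =>
    (measurableSet_le measurable_const (measurable_pi_apply n).abs).inter
      (Finset.measurableSet_biInter _ fun j _ =>
        measurableSet_lt (measurable_pi_apply j).abs measurable_const)
  set F : ℕ → Set Ω := fun n => (fun ω j => S (min j n) ω) ⁻¹' W n with hF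
  have hmemF : ∀ n ω, ω ∈ F n ↔ 2 * r ≤ |S n ω| ∧ ∀ j < n, |S j ω| < 2 * r := by
    intro n ω
    simp only [hF, hW, mem_preimage, mem_inter_iff, Set.mem_ofPred_eq, mem_iInter,
      Finset.mem_range, min_self]
    refine and_congr_right fun _ => forall₂_congr fun j hj => ?_
    rw [min_eq_left hj.le]
  have hFm : ∀ n, MeasurableSet (F n) := fun n =>
    (measurable_pi_lambda _ fun j => hSm (min j n)) (hWm n)
  set C : Set Ω := {ω | r ≤ |S m ω|} with hC
  have hCm : MeasurableSet C := measurableSet_le measurable_const (hSm m).abs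
  have hlt : ∀ i j, i < j → Disjoint (F i) (F j) := fun i j hij =>
    disjoint_left.2 fun ω h1 h2 =>
      absurd ((hmemF j ω).1 h2 |>.2 i hij) (not_lt.2 ((hmemF i ω).1 h1).1)
  have hdisj : ∀ i j, i ≠ j → Disjoint (F i) (F j) := fun i j hij =>
    (lt_or_gt_of_ne hij).elim (hlt i j) fun h => (hlt j i h).symm
  have hstep : ∀ n ≤ m, μ (F n) ≤ 2 * μ (F n ∩ C) := by
    intro n hn
    have hDm : MeasurableSet {y : ℝ | |y| < r} := measurableSet_lt measurable_id.abs measurable_const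
    have hD : 1 / 2 ≤ μ ((fun ω => S m ω - S n ω) ⁻¹' {y : ℝ | |y| < r}) := by
      have h1 := prob_add_prob_compl (μ := μ) (((hSm m).sub (hSm n)) hDm)
      have h2 : ((S m - S n) ⁻¹' {y : ℝ | |y| < r})ᶜ = {ω | r ≤ |S m ω - S n ω|} := by
        ext ω
        simp
      rw [h2] at h1
      have h3 : (1 / 2 + 1 / 2 : ℝ≥0∞) = 1 := ENNReal.add_halves 1
      have h4 : (1 / 2 + 1 / 2 : ℝ≥0∞) ≤ μ ((S m - S n) ⁻¹' {y : ℝ | |y| < r}) + 1 / 2 := by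
        rw [h3]
        exact h1.symm.le.trans (add_le_add le_rfl (h n hn))
      exact (ENNReal.add_le_add_iff_right (by simp)).1 h4
    have hi := (indepFun_partialSums_increment hX hind hn).measure_inter_preimage_eq_mul _ _
      (hWm n) hDm
    have hsub : F n ∩ (fun ω => S m ω - S n ω) ⁻¹' {y : ℝ | |y| < r} ⊆ F n ∩ C := by
      rintro ω ⟨h1, h2⟩
      refine ⟨h1, ?_⟩
      have h3 := ((hmemF n ω).1 h1).1
      have h4 : |S m ω - S n ω| < r := h2
      have h5 := abs_sub_abs_le_abs_sub (S n ω) (S m ω)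
      rw [abs_sub_comm] at h5
      change r ≤ |S m ω|
      linarith
    calc μ (F n) = 2 * (μ (F n) * (1 / 2)) := by
          rw [mul_comm (μ (F n)), ← mul_assoc, one_div,
            ENNReal.mul_inv_cancel two_ne_zero ENNReal.ofNat_ne_top, one_mul]
      _ ≤ 2 * (μ (F n) * μ ((fun ω => S m ω - S n ω) ⁻¹' {y : ℝ | |y| < r})) := by gcongr
      _ = 2 * μ (F n ∩ (fun ω => S m ω - S n ω) ⁻¹' {y : ℝ | |y| < r}) := by rw [← hi]
      _ ≤ _ := by gcongr
  calc μ {ω | ∃ n ≤ m, 2 * r ≤ |S n ω|} ≤ μ (⋃ n ∈ Finset.range (m + 1), F n) := by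
        refine measure_mono fun ω hω => ?_
        classical
        have hω' : ∃ n, n ≤ m ∧ 2 * r ≤ |S n ω| := hω
        simp only [mem_iUnion]
        refine ⟨Nat.find hω', Finset.mem_range.2 (Nat.lt_succ_of_le (Nat.find_spec hω').1),
          (hmemF _ _).2 ⟨(Nat.find_spec hω').2, fun j hj => ?_⟩⟩
        have := Nat.find_min hω' hj
        by_contra h'
        exact this ⟨hj.le.trans (Nat.find_spec hω').1, not_lt.1 h'⟩
    _ ≤ ∑ n ∈ Finset.range (m + 1), μ (F n) := measure_biUnion_finset_le _ _
    _ ≤ ∑ n ∈ Finset.range (m + 1), 2 * μ (F n ∩ C) :=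
        Finset.sum_le_sum fun n hn => hstep n (Nat.le_of_lt_succ (Finset.mem_range.1 hn))
    _ = 2 * μ (⋃ n ∈ Finset.range (m + 1), F n ∩ C) := by
        rw [← Finset.mul_sum, measure_biUnion_finset
          (fun i _ j _ hij => (hdisj i j hij).mono inter_subset_left inter_subset_left)
          fun n _ => (hFm n).inter hCm]
    _ ≤ 2 * μ C := by
        gcongr
        exact iUnion₂_subset fun n _ => inter_subset_right

/-- Past some `k` the ratio bound applies and `n ≤ m`; the finitely many earlier values are
dominated by `η m` once `m` is large. -/
theorem eventually_forall_le_mul_of_tendsto_div {c : ℕ → ℝ}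
    (h : Tendsto (fun n : ℕ => c n / n) atTop (nhds 0)) {η : ℝ} (hη : 0 < η) :
    ∀ᶠ m : ℕ in atTop, ∀ n ≤ m, c n ≤ η * m := by
  obtain ⟨k, hk⟩ := eventually_atTop.1 (h.eventually (ge_mem_nhds hη))
  obtain ⟨M, hM⟩ := exists_nat_ge ((∑ n ∈ Finset.range (k + 1), |c n|) / η)
  filter_upwards [eventually_ge_atTop M] with m hm n hn
  rcases lt_or_ge k n with h1 | h1
  · have hn0 : (0 : ℝ) < n := Nat.cast_pos.2 (Nat.zero_lt_of_lt h1)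
    calc c n ≤ η * n := (div_le_iff₀ hn0).1 (hk n h1.le)
      _ ≤ η * m := by gcongr
  · calc c n ≤ |c n| := le_abs_self _
      _ ≤ ∑ n ∈ Finset.range (k + 1), |c n| :=
          Finset.single_le_sum (f := fun n => |c n|) (fun _ _ => abs_nonneg _)
            (Finset.mem_range.2 (Nat.lt_succ_of_le h1))
      _ ≤ M * η := (div_le_iff₀ hη).1 hM
      _ ≤ η * m := by
          rw [mul_comm]
          gcongr

theorem tendsto_integral_abs_sum_div [IsProbabilityMeasure μ] {X : ℕ → Ω → ℝ} (hX : IsIID μ X)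
    (hint : Integrable (X 0) μ) (h0 : ∫ ω, X 0 ω ∂μ = 0) :
    Tendsto (fun n : ℕ => (∫ ω, |∑ i ∈ Finset.range n, X i ω| ∂μ) / n) atTop (nhds 0) := by
  have h := strong_law_Lp le_rfl ENNReal.one_ne_top X (memLp_one_iff_integrable.2 hint)
    (fun i j hij => hX.indep.indepFun hij) hX.ident
  have h' := (ENNReal.tendsto_toReal ENNReal.zero_ne_top).comp h
  rw [ENNReal.toReal_zero] at h'
  refine h'.congr fun n => ?_
  have hi : ∀ i, Integrable (X i) μ := fun i => (hX.ident i).integrable_iff.2 hint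
  have hs : Integrable (fun ω => (n : ℝ)⁻¹ • ∑ i ∈ Finset.range n, X i ω) μ :=
    (integrable_finsetSum (Finset.range n) fun i _ => hi i).const_mul (n : ℝ)⁻¹
  rw [Function.comp_apply, h0]
  simp only [sub_zero]
  rw [eLpNorm_one_eq_lintegral_enorm, ← integral_norm_eq_lintegral_enorm hs.aestronglyMeasurable]
  simp only [norm_smul, norm_inv, Real.norm_eq_abs, Nat.abs_cast]
  rw [integral_const_mul, div_eq_inv_mul]

/-- Markov's inequality, with `E|S_n| = o(n)` from the law of large numbers in `L¹`. The bound `1/4`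
is used twice to meet Ottaviani's hypothesis `1/2`. -/
theorem eventually_measure_partialSum_ge_le [IsProbabilityMeasure μ] {X : ℕ → Ω → ℝ}
    (hX : IsIID μ X) (hint : Integrable (X 0) μ) (h0 : ∫ ω, X 0 ω ∂μ = 0) {η : ℝ} (hη : 0 < η) :
    ∀ᶠ m : ℕ in atTop, ∀ n ≤ m, μ {ω | η * m ≤ |∑ i ∈ Finset.range n, X i ω|} ≤ 1 / 4 := by
  have hi : ∀ i, Integrable (X i) μ := fun i => (hX.ident i).integrable_iff.2 hint
  filter_upwards [eventually_forall_le_mul_of_tendsto_div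
    (tendsto_integral_abs_sum_div hX hint h0) (show 0 < η / 4 by positivity),
    eventually_gt_atTop 0] with m hm hm0 n hn
  have hm0' : (0 : ℝ) < m := Nat.cast_pos.2 hm0
  have h1 := mul_meas_ge_le_integral_of_nonneg (μ := μ)
    (f := fun ω => |∑ i ∈ Finset.range n, X i ω|) (ae_of_all _ fun ω => abs_nonneg _)
    (integrable_finsetSum _ fun i _ => hi i).abs (η * m)
  have h2 : μ.real {ω | η * m ≤ |∑ i ∈ Finset.range n, X i ω|} ≤ 1 / 4 := by
    have h3 : η * m * μ.real {ω | η * m ≤ |∑ i ∈ Finset.range n, X i ω|} ≤ η * m * (1 / 4) :=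
      (h1.trans (hm n hn)).trans (le_of_eq (by ring))
    exact le_of_mul_le_mul_left h3 (by positivity)
  rw [← ENNReal.ofReal_toReal (measure_ne_top μ {ω | η * m ≤ |∑ i ∈ Finset.range n, X i ω|})]
  refine (ENNReal.ofReal_le_ofReal h2).trans (le_of_eq ?_)
  rw [ENNReal.ofReal_div_of_pos (by norm_num)]
  simp

theorem eventually_measure_exists_partialSum_ge_le [IsProbabilityMeasure μ] {X : ℕ → Ω → ℝ}
    (hX : IsIID μ X) (hint : Integrable (X 0) μ) (h0 : ∫ ω, X 0 ω ∂μ = 0) {a : ℝ} (ha : 0 < a) :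
    ∀ᶠ m : ℕ in atTop, μ {ω | ∃ n ≤ m, 2 * (a * m) ≤ |∑ i ∈ Finset.range n, X i ω|} ≤
      2 * μ {ω | a * m ≤ |∑ i ∈ Finset.range m, X i ω|} := by
  filter_upwards [eventually_measure_partialSum_ge_le hX hint h0 (half_pos ha)] with m hm
  refine measure_exists_partialSum_ge_le hX.measurable hX.indep fun n hn => ?_
  calc μ {ω | a * m ≤ |∑ i ∈ Finset.range m, X i ω - ∑ i ∈ Finset.range n, X i ω|}
      ≤ μ ({ω | a / 2 * m ≤ |∑ i ∈ Finset.range m, X i ω|} ∪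
          {ω | a / 2 * m ≤ |∑ i ∈ Finset.range n, X i ω|}) := by
        refine measure_mono fun ω hω => ?_
        by_contra h
        simp only [mem_union, Set.mem_ofPred_eq, not_or, not_le] at h hω
        have := abs_sub (∑ i ∈ Finset.range m, X i ω) (∑ i ∈ Finset.range n, X i ω)
        linarith [h.1, h.2]
    _ ≤ 1 / 4 + 1 / 4 := (measure_union_le _ _).trans (add_le_add (hm m le_rfl) (hm n hn))
    _ = 1 / 2 := by
        rw [ENNReal.div_add_div_same, ← ENNReal.toReal_eq_toReal_iff' (by finiteness)
          (by finiteness)]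
        norm_num [ENNReal.toReal_div]

end Maximal

/-! ### From the deviation series to the last time -/

section LastTimeOfSeries

variable {Ω : Type*} [MeasurableSpace Ω] {μ : Measure Ω} {G : ℝ → ℝ}

theorem le_abs_cesaroMean_iff {Ω : Type*} {X : ℕ → Ω → ℝ} {a : ℝ} {n : ℕ} (hn : 0 < n) {ω : Ω} :
    a ≤ |cesaroMean X n ω| ↔ a * n ≤ |∑ i ∈ Finset.range n, X i ω| := by
  have : (0 : ℝ) < n := Nat.cast_pos.2 hn
  rw [cesaroMean, abs_div, abs_of_pos this, le_div_iff₀ this]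

/-- The block `[l, 2l)` has `l` terms, each at least `G l / (2l)` by monotonicity. -/
theorem ennLift_le_two_mul_tsum (hG0 : ∀ t, 0 ≤ t → 0 ≤ G t) (hG : MonotoneOn G (Ici 0)) {l : ℕ}
    (hl : 1 ≤ l) {p : ℕ → ℝ≥0∞} (hp : ∀ m ∈ Finset.Ico l (2 * l), 1 ≤ p m) :
    ennLift G l ≤
      2 * ∑' m : ℕ, ENNReal.ofReal (((m + 1 : ℕ) : ℝ)⁻¹ * G ((m + 1 : ℕ) : ℝ)) * p (m + 1) := by
  have hl0 : (0 : ℝ) < l := Nat.cast_pos.2 hl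
  have hGl : 0 ≤ G l := hG0 _ hl0.le
  calc ennLift G l = 2 * ((l : ℝ≥0∞) * ENNReal.ofReal ((2 * l : ℝ)⁻¹ * G l)) := by
        rw [ennLift_of_nonneg hl0.le, ← ENNReal.ofReal_natCast, ← ENNReal.ofReal_mul hl0.le,
          ← ENNReal.ofReal_ofNat, ← ENNReal.ofReal_mul zero_le_two]
        congr 1
        field_simp
    _ = 2 * ∑ m ∈ Finset.Ico (l - 1) (2 * l - 1), ENNReal.ofReal ((2 * l : ℝ)⁻¹ * G l) := by
        rw [Finset.sum_const, nsmul_eq_mul, Nat.card_Ico]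
        congr 3
        omega
    _ ≤ 2 * ∑ m ∈ Finset.Ico (l - 1) (2 * l - 1),
          ENNReal.ofReal (((m + 1 : ℕ) : ℝ)⁻¹ * G ((m + 1 : ℕ) : ℝ)) * p (m + 1) := by
        gcongr 2 * ?_
        refine Finset.sum_le_sum fun m hm => ?_
        rw [Finset.mem_Ico] at hm
        rw [← mul_one (ENNReal.ofReal _)]
        refine mul_le_mul' (ENNReal.ofReal_le_ofReal ?_) (hp _ (Finset.mem_Ico.2 (by omega)))
        have h1 : ((m + 1 : ℕ) : ℝ) ≤ 2 * l := by exact_mod_cast (by omega : m + 1 ≤ 2 * l)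
        have h2 : (l : ℝ) ≤ ((m + 1 : ℕ) : ℝ) := by exact_mod_cast (by omega : l ≤ m + 1)
        gcongr
        exact hG (mem_Ici.2 hl0.le) (mem_Ici.2 (Nat.cast_nonneg _)) h2
    _ ≤ _ := by
        gcongr
        exact ENNReal.sum_le_tsum _

theorem gConvergesTo_zero_of_deviationSeries_lt_top [IsProbabilityMeasure μ]
    (hG0 : ∀ t, 0 ≤ t → 0 ≤ G t) (hG : MonotoneOn G (Ici 0)) (hGt : Tendsto G atTop atTop)
    {X : ℕ → Ω → ℝ} (hX : IsIID μ X) (hint : Integrable (X 0) μ) (h0 : ∫ ω, X 0 ω ∂μ = 0)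
    (h : ∀ a : ℝ, 0 < a → deviationSeries μ G (cesaroMean X) a < ∞) :
    GConvergesTo μ G (cesaroMean X) 0 := by
  intro a ha
  have hSm : ∀ n, Measurable fun ω => ∑ i ∈ Finset.range n, X i ω := fun n =>
    Finset.measurable_sum _ fun i _ => hX.measurable i
  -- The threshold is `a m / 2`: a deviation `|S_l| ≥ a l` exceeds it whenever `m < 2l`. Ottaviani's
  -- inequality halves it again, to `a m / 4`.
  set E : ℕ → Set Ω := fun m => {ω | ∃ n ≤ m, 2 * (a / 4 * m) ≤ |∑ i ∈ Finset.range n, X i ω|}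
    with hE
  have hEm : ∀ m, MeasurableSet (E m) := fun m => by
    have : E m = ⋃ n ∈ Finset.range (m + 1),
        {ω | 2 * (a / 4 * m) ≤ |∑ i ∈ Finset.range n, X i ω|} := by
      ext ω
      simp [hE]
    rw [this]
    exact Finset.measurableSet_biUnion _ fun n _ => measurableSet_le measurable_const (hSm n).abs
  set w : ℕ → ℝ≥0∞ := fun m => ENNReal.ofReal (((m + 1 : ℕ) : ℝ)⁻¹ * G ((m + 1 : ℕ) : ℝ)) with hw
  have hwfin : ∀ m, w m ≠ ∞ := fun m => ENNReal.ofReal_ne_top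
  have hpt : ∀ ω, extendTop G (lastTime (cesaroMean X) 0 a ω) ≤
      ennLift G 0 + 2 * ∑' m, w m * (E (m + 1)).indicator 1 ω := by
    intro ω
    refine extendTop_lastTime_le hGt le_self_add fun l hl hal => le_trans ?_ le_add_self
    rw [sub_zero, le_abs_cesaroMean_iff hl] at hal
    refine ennLift_le_two_mul_tsum hG0 hG hl (p := fun m => (E m).indicator 1 ω) fun m hm => ?_
    rw [Finset.mem_Ico] at hm
    have : ω ∈ E m := by
      refine ⟨l, hm.1, le_trans ?_ hal⟩
      have : (m : ℝ) ≤ 2 * l := by exact_mod_cast hm.2.le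
      nlinarith
    rw [indicator_of_mem this]
    rfl
  have hsum : ∑' m, w m * μ (E (m + 1)) < ∞ := by
    obtain ⟨M, hM⟩ := eventually_atTop.1
      (eventually_measure_exists_partialSum_ge_le hX hint h0 (show 0 < a / 4 by positivity))
    refine ENNReal.tsum_lt_top_of_tail M
      (fun n => ENNReal.mul_ne_top (hwfin n) (measure_ne_top μ _)) ?_
    calc ∑' m, w (m + M) * μ (E (m + M + 1))
        ≤ ∑' m, 2 * (w (m + M) * μ {ω | a / 4 ≤ |cesaroMean X (m + M + 1) ω|}) := by
          refine ENNReal.tsum_le_tsum fun m => ?_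
          simp only [le_abs_cesaroMean_iff (Nat.succ_pos _)]
          calc w (m + M) * μ (E (m + M + 1)) ≤ w (m + M) * (2 * _) := by
                gcongr
                exact hM (m + M + 1) (by omega)
            _ = _ := by ring
      _ = 2 * ∑' m, w (m + M) * μ {ω | a / 4 ≤ |cesaroMean X (m + M + 1) ω|} :=
          ENNReal.tsum_mul_left
      _ ≤ 2 * deviationSeries μ G (cesaroMean X) (a / 4) := by
          gcongr
          exact ENNReal.tsum_comp_le_tsum_of_injective (add_left_injective M)
            fun m => w m * μ {ω | a / 4 ≤ |cesaroMean X (m + 1) ω|}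
      _ < ∞ := ENNReal.mul_lt_top (by simp) (h _ (by positivity))
  calc ∫⁻ ω, extendTop G (lastTime (cesaroMean X) 0 a ω) ∂μ
      ≤ ∫⁻ ω, (ennLift G 0 + 2 * ∑' m, w m * (E (m + 1)).indicator 1 ω) ∂μ := lintegral_mono hpt
    _ = ennLift G 0 + 2 * ∑' m, w m * μ (E (m + 1)) := by
        rw [lintegral_add_left measurable_const, lintegral_const, measure_univ, mul_one,
          lintegral_const_mul' 2 _ (by simp), lintegral_tsum fun m =>
            ((measurable_one.indicator (hEm (m + 1))).const_mul (w m)).aemeasurable]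
        congr 2
        refine tsum_congr fun m => ?_
        rw [lintegral_const_mul' _ _ (hwfin m), lintegral_indicator_one (hEm _)]
    _ < ∞ := ENNReal.add_lt_top.2 ⟨(ennLift_ne_top 0).lt_top, ENNReal.mul_lt_top (by simp) hsum⟩

end LastTimeOfSeries

/-! ### Polynomial growth from doubling -/

section Growth

variable {H : ℝ → ℝ≥0∞} {r : ℕ} {T : ℝ}

/-- Iterate doubling `i + 1` times, where `2 ^ i ≤ y / x < 2 ^ (i + 1)`; rounding up to a power of
two accounts for the extra factor 2. -/
theorem le_pow_mul_of_doubling (hH : Monotone H) (hT : 0 < T)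
    (hd : ∀ t, T ≤ t → H (2 * t) ≤ 2 ^ r * H t) {x y : ℝ} (hx : T ≤ x) (hxy : x ≤ y) :
    H y ≤ ENNReal.ofReal ((2 * (y / x)) ^ r) * H x := by
  have hx0 : 0 < x := hT.trans_le hx
  have hit : ∀ j : ℕ, H (2 ^ j * x) ≤ (2 ^ j) ^ r * H x := by
    intro j
    induction j with
    | zero => simp
    | succ j ih =>
      have h1 : T ≤ 2 ^ j * x := hx.trans (le_mul_of_one_le_left hx0.le (one_le_pow₀ one_le_two))
      calc H (2 ^ (j + 1) * x) = H (2 * (2 ^ j * x)) := by ring_nf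
        _ ≤ 2 ^ r * H (2 ^ j * x) := hd _ h1
        _ ≤ 2 ^ r * ((2 ^ j) ^ r * H x) := by gcongr
        _ = (2 ^ (j + 1)) ^ r * H x := by ring
  obtain ⟨i, hi1, hi2⟩ := exists_nat_pow_near ((one_le_div hx0).2 hxy) (one_lt_two (α := ℝ))
  calc H y ≤ H (2 ^ (i + 1) * x) := hH ((div_le_iff₀ hx0).1 hi2.le)
    _ ≤ (2 ^ (i + 1)) ^ r * H x := hit _
    _ = ENNReal.ofReal ((2 ^ (i + 1)) ^ r) * H x := by
        rw [ENNReal.ofReal_pow (by positivity), ENNReal.ofReal_pow (by positivity),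
          ENNReal.ofReal_ofNat]
    _ ≤ _ := by
        gcongr
        rw [pow_succ, mul_comm]
        gcongr

theorem tsum_indicator_inv_sq_le {x : ℝ} (hx : 0 < x) :
    ∑' n : ℕ, (if x ≤ n then ENNReal.ofReal (((n : ℝ) ^ 2)⁻¹) else 0) ≤ ENNReal.ofReal (2 / x) := by
  obtain ⟨k, hk⟩ : ∃ k, ⌈x⌉₊ = k + 1 := Nat.exists_eq_succ_of_ne_zero (Nat.ceil_pos.2 hx).ne'
  refine ENNReal.tsum_le_of_sum_range_le fun N => ?_
  rw [← Finset.sum_filter, ← ENNReal.ofReal_sum_of_nonneg fun _ _ => by positivity]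
  refine ENNReal.ofReal_le_ofReal ?_
  calc ∑ n ∈ (Finset.range N).filter (fun n : ℕ => x ≤ n), ((n : ℝ) ^ 2)⁻¹
      ≤ ∑ n ∈ Finset.Ioo k N, ((n : ℝ) ^ 2)⁻¹ := by
        refine Finset.sum_le_sum_of_subset_of_nonneg (fun n hn => ?_) fun _ _ _ => by positivity
        rw [Finset.mem_filter, Finset.mem_range] at hn
        have := Nat.ceil_le.2 hn.2
        exact Finset.mem_Ioo.2 ⟨by omega, hn.1⟩
    _ ≤ 2 / (k + 1) := sum_Ioo_inv_sq_le k N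
    _ ≤ 2 / x := by
        gcongr
        have := Nat.le_ceil x
        rw [hk] at this
        exact_mod_cast this

/-- The power `r + 1` beats the growth `n ^ r` of `H` by one, so with the weight `n⁻¹` the terms
decay like `n⁻²`, and the tail from `x = max z T` contributes at most `2 / x`. The maximum with `T`
keeps to the range where doubling holds. -/
theorem tsum_truncated_moment_le (hH : Monotone H) (hT : 0 < T)
    (hd : ∀ t, T ≤ t → H (2 * t) ≤ 2 ^ r * H t) {z : ℝ} (hz : 0 ≤ z) :
    ∑' n : ℕ, (if max z T ≤ n then
      ENNReal.ofReal ((n : ℝ)⁻¹ * (z * (z / n) ^ (r + 1))) * H n else 0) ≤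
        ENNReal.ofReal (2 ^ (r + 1)) * (ENNReal.ofReal z * H (max z T)) := by
  set x := max z T with hx
  have hx0 : 0 < x := hT.trans_le (le_max_right _ _)
  have hzx : z ≤ x := le_max_left _ _
  calc ∑' n : ℕ, (if x ≤ n then ENNReal.ofReal ((n : ℝ)⁻¹ * (z * (z / n) ^ (r + 1))) * H n else 0)
      ≤ ∑' n : ℕ, (ENNReal.ofReal (2 ^ r * z * x) * H x) *
          (if x ≤ n then ENNReal.ofReal (((n : ℝ) ^ 2)⁻¹) else 0) := by
        refine ENNReal.tsum_le_tsum fun n => ?_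
        split_ifs with h
        · have hn : (0 : ℝ) < n := hx0.trans_le h
          calc ENNReal.ofReal ((n : ℝ)⁻¹ * (z * (z / n) ^ (r + 1))) * H n
              ≤ ENNReal.ofReal ((n : ℝ)⁻¹ * (z * (z / n) ^ (r + 1))) *
                (ENNReal.ofReal ((2 * (n / x)) ^ r) * H x) := by
                gcongr
                exact le_pow_mul_of_doubling hH hT hd (le_max_right _ _) h
            _ = ENNReal.ofReal ((n : ℝ)⁻¹ * (z * (z / n) ^ (r + 1)) * (2 * (n / x)) ^ r) * H x := by
                rw [← mul_assoc, ← ENNReal.ofReal_mul (by positivity)]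
            _ ≤ ENNReal.ofReal (2 ^ r * z * x * ((n : ℝ) ^ 2)⁻¹) * H x := by
                gcongr ENNReal.ofReal ?_ * _
                calc (n : ℝ)⁻¹ * (z * (z / n) ^ (r + 1)) * (2 * (n / x)) ^ r
                    ≤ (n : ℝ)⁻¹ * (z * (x / n) ^ (r + 1)) * (2 * (n / x)) ^ r := by gcongr
                  _ = 2 ^ r * z * x * ((n : ℝ) ^ 2)⁻¹ := by
                    rw [mul_pow, div_pow, div_pow]
                    field_simp
                    ring
            _ = _ := by
                rw [ENNReal.ofReal_mul (by positivity)]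
                ring
        · simp
    _ ≤ (ENNReal.ofReal (2 ^ r * z * x) * H x) * ENNReal.ofReal (2 / x) := by
        rw [ENNReal.tsum_mul_left]
        gcongr
        exact tsum_indicator_inv_sq_le hx0
    _ = ENNReal.ofReal (2 ^ (r + 1)) * (ENNReal.ofReal z * H x) := by
        rw [mul_right_comm, ← ENNReal.ofReal_mul (by positivity), ← mul_assoc,
          ← ENNReal.ofReal_mul (by positivity)]
        congr 2
        field_simp
        ring

theorem tsum_indicator_le_mul (hH : Monotone H) {z : ℝ} (hz : 0 ≤ z) :
    ∑' n : ℕ, {y : ℝ | ((n + 1 : ℕ) : ℝ) ≤ y}.indicator (fun _ => H (n + 1 : ℕ)) z ≤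
      ENNReal.ofReal z * H z := by
  refine ENNReal.tsum_le_of_sum_range_le fun N => ?_
  calc ∑ n ∈ Finset.range N, {y : ℝ | ((n + 1 : ℕ) : ℝ) ≤ y}.indicator (fun _ => H (n + 1 : ℕ)) z
      ≤ ∑ n ∈ Finset.range N, if n ∈ Finset.range ⌊z⌋₊ then H z else 0 := by
        refine Finset.sum_le_sum fun n _ => ?_
        by_cases h : ((n + 1 : ℕ) : ℝ) ≤ z
        · rw [if_pos (Finset.mem_range.2 (Nat.lt_of_succ_le (Nat.le_floor h))),
            indicator_of_mem (by exact h)]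
          exact hH h
        · rw [indicator_of_notMem (by exact h)]
          exact zero_le
    _ ≤ ∑ n ∈ Finset.range ⌊z⌋₊, H z := by
        rw [← Finset.sum_filter]
        refine Finset.sum_le_sum_of_subset fun n hn => (Finset.mem_filter.1 hn).2
    _ ≤ ENNReal.ofReal z * H z := by
        rw [Finset.sum_const, Finset.card_range, nsmul_eq_mul]
        gcongr
        rw [← ENNReal.ofReal_natCast]
        exact ENNReal.ofReal_le_ofReal (Nat.floor_le hz)

/-- Doubling makes the moment condition invariant under scaling inside `H`, which is what rescaling
and centering require. -/
theorem lintegral_mul_comp_mul_lt_top {Ω : Type*} [MeasurableSpace Ω] {μ : Measure Ω}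
    [IsProbabilityMeasure μ] (hH : Monotone H) (hfin : ∀ t, H t ≠ ∞) (hT : 0 < T)
    (hd : ∀ t, T ≤ t → H (2 * t) ≤ 2 ^ r * H t) {Y : Ω → ℝ} (b : ℝ)
    (h : ∫⁻ ω, ENNReal.ofReal |Y ω| * H |Y ω| ∂μ < ∞) :
    ∫⁻ ω, ENNReal.ofReal |Y ω| * H (b * |Y ω|) ∂μ < ∞ := by
  set c := max b 1 with hc
  have hc1 : 1 ≤ c := le_max_right _ _
  calc ∫⁻ ω, ENNReal.ofReal |Y ω| * H (b * |Y ω|) ∂μ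
      ≤ ∫⁻ ω, (ENNReal.ofReal T * H (c * T) +
          ENNReal.ofReal ((2 * c) ^ r) * (ENNReal.ofReal |Y ω| * H |Y ω|)) ∂μ := by
        refine lintegral_mono fun ω => ?_
        have h1 : H (b * |Y ω|) ≤ H (c * |Y ω|) := hH (by gcongr; exact le_max_left _ _)
        rcases le_total |Y ω| T with h2 | h2
        · refine le_trans ?_ le_self_add
          gcongr
          exact h1.trans (hH (by gcongr))
        · refine le_trans ?_ le_add_self
          have h0 : 0 < |Y ω| := hT.trans_le h2
          have h3 := le_pow_mul_of_doubling hH hT hd h2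
            (le_mul_of_one_le_left h0.le hc1)
          rw [mul_div_cancel_right₀ _ h0.ne'] at h3
          calc ENNReal.ofReal |Y ω| * H (b * |Y ω|)
              ≤ ENNReal.ofReal |Y ω| * (ENNReal.ofReal ((2 * c) ^ r) * H |Y ω|) := by
                gcongr
                exact h1.trans h3
            _ = _ := by ring
    _ = ENNReal.ofReal T * H (c * T) +
          ENNReal.ofReal ((2 * c) ^ r) * ∫⁻ ω, ENNReal.ofReal |Y ω| * H |Y ω| ∂μ := by
        rw [lintegral_add_left measurable_const,
          lintegral_const_mul' (ENNReal.ofReal ((2 * c) ^ r)) _ ENNReal.ofReal_ne_top,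
          lintegral_const, measure_univ, mul_one]
    _ < ∞ := ENNReal.add_lt_top.2 ⟨ENNReal.mul_lt_top ENNReal.ofReal_lt_top (hfin _).lt_top,
        ENNReal.mul_lt_top ENNReal.ofReal_lt_top h⟩

end Growth

/-! ### Exponential bounds for bounded summands -/

section Chernoff

variable {Ω : Type*} [MeasurableSpace Ω] {μ : Measure Ω}

/-- Hölder's inequality for `g` under the measure with density `f`. With `f = |Z|` and `g = |Z|/n`
it turns a power of the truncated variance into a single truncated moment. -/
theorem lintegral_mul_pow_le {f g : Ω → ℝ≥0∞} (hf : Measurable f) (hg : Measurable g) {K : ℕ}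
    (hK : 1 ≤ K) :
    (∫⁻ ω, f ω * g ω ∂μ) ^ K ≤ (∫⁻ ω, f ω ∂μ) ^ (K - 1) * ∫⁻ ω, f ω * g ω ^ K ∂μ := by
  have hK0 : (0 : ℝ) < K := Nat.cast_pos.2 hK
  have h := eLpNorm'_le_eLpNorm'_mul_rpow_measure_univ (μ := μ.withDensity f) (p := 1) (q := K)
    one_pos (by exact_mod_cast hK) hg.aestronglyMeasurable
  simp only [eLpNorm', enorm_eq_self, ENNReal.rpow_one, one_div, inv_one, ENNReal.rpow_natCast,
    withDensity_apply _ MeasurableSet.univ, Measure.restrict_univ] at h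
  rw [lintegral_withDensity_eq_lintegral_mul _ hf hg,
    lintegral_withDensity_eq_lintegral_mul _ hf (hg.pow_const K)] at h
  calc (∫⁻ ω, f ω * g ω ∂μ) ^ K
      ≤ ((∫⁻ ω, f ω * g ω ^ K ∂μ) ^ (K : ℝ)⁻¹ * (∫⁻ ω, f ω ∂μ) ^ (1 - (K : ℝ)⁻¹)) ^ K := by
        gcongr
        exact h
    _ = _ := by
        rw [mul_pow, ← ENNReal.rpow_natCast, ← ENNReal.rpow_mul, inv_mul_cancel₀ hK0.ne',
          ENNReal.rpow_one, ← ENNReal.rpow_natCast, ← ENNReal.rpow_mul, sub_mul,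
          inv_mul_cancel₀ hK0.ne', one_mul, mul_comm]
        congr 1
        rw [← ENNReal.rpow_natCast, Nat.cast_sub hK, Nat.cast_one]

theorem exp_le_one_add_add_sq_mul_exp_abs (y : ℝ) :
    Real.exp y ≤ 1 + y + y ^ 2 * Real.exp |y| := by
  have h := Complex.norm_exp_sub_sum_le_norm_mul_exp (y : ℂ) 2
  have e : Complex.exp y - ∑ m ∈ Finset.range 2, (y : ℂ) ^ m / m.factorial =
      ((Real.exp y - 1 - y : ℝ) : ℂ) := by
    simp [Finset.sum_range_succ]
    ring
  rw [e, Complex.norm_real, Complex.norm_real, Real.norm_eq_abs, Real.norm_eq_abs, sq_abs] at h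
  linarith [le_abs_self (Real.exp y - 1 - y)]

theorem measureReal_sum_ge_le_exp [IsProbabilityMeasure μ] {B : ℕ → Ω → ℝ}
    (hB : ∀ i, Measurable (B i)) (hind : iIndepFun B μ)
    (hid : ∀ i, IdentDistrib (B i) (B 0) μ μ) (hb : ∀ i ω, |B i ω| ≤ 1) (n : ℕ) (u : ℝ) {t : ℝ}
    (ht : 0 ≤ t) :
    μ.real {ω | u ≤ ∑ i ∈ Finset.range n, B i ω} ≤
      Real.exp (-t * u + (t * (n * ∫ ω, B 0 ω ∂μ) +
        t ^ 2 * Real.exp t * (n * ∫ ω, B 0 ω ^ 2 ∂μ))) := by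
  have hexp : ∀ i, Integrable (fun ω => Real.exp (t * B i ω)) μ := fun i =>
    Integrable.of_bound (by fun_prop) (Real.exp t) (ae_of_all _ fun ω => by
      rw [Real.norm_eq_abs, Real.abs_exp, Real.exp_le_exp]
      nlinarith [(abs_le.1 (hb i ω)).2])
  have hi1 : Integrable (B 0) μ :=
    Integrable.of_bound (hB 0).aestronglyMeasurable 1 (ae_of_all _ fun ω => hb 0 ω)
  have hi2 : Integrable (fun ω => B 0 ω ^ 2) μ :=
    Integrable.of_bound ((hB 0).pow_const 2).aestronglyMeasurable 1 (ae_of_all _ fun ω => by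
      rw [Real.norm_eq_abs, abs_pow]
      exact pow_le_one₀ (abs_nonneg _) (hb 0 ω))
  have hmgf : mgf (B 0) μ t ≤
      Real.exp (t * ∫ ω, B 0 ω ∂μ + t ^ 2 * Real.exp t * ∫ ω, B 0 ω ^ 2 ∂μ) := by
    calc mgf (B 0) μ t ≤ ∫ ω, (1 + t * B 0 ω + t ^ 2 * Real.exp t * B 0 ω ^ 2) ∂μ := by
          refine integral_mono (hexp 0)
            (((integrable_const 1).add (hi1.const_mul t)).add (hi2.const_mul _)) fun ω => ?_
          refine (exp_le_one_add_add_sq_mul_exp_abs _).trans ?_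
          have h1 : |t * B 0 ω| ≤ t := by
            rw [abs_mul, abs_of_nonneg ht]
            exact mul_le_of_le_one_right ht (hb 0 ω)
          have h2 : (t * B 0 ω) ^ 2 * Real.exp |t * B 0 ω| ≤ (t * B 0 ω) ^ 2 * Real.exp t := by
            gcongr
          linarith
      _ = t * ∫ ω, B 0 ω ∂μ + t ^ 2 * Real.exp t * ∫ ω, B 0 ω ^ 2 ∂μ + 1 := by
          have hi3 : Integrable (fun ω => 1 + t * B 0 ω) μ :=
            (integrable_const 1).add (hi1.const_mul t)
          rw [integral_add hi3 (hi2.const_mul _), integral_add (integrable_const 1) (hi1.const_mul t), integral_const_mul,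
            integral_const_mul]
          simp
          ring
      _ ≤ _ := Real.add_one_le_exp _
  have hsum : Integrable (fun ω => Real.exp (t * (∑ i ∈ Finset.range n, B i) ω)) μ :=
    hind.integrable_exp_mul_sum hB fun i _ => hexp i
  have h := measure_ge_le_exp_mul_mgf (X := ∑ i ∈ Finset.range n, B i) u ht hsum
  rw [hind.mgf_sum hB, Finset.prod_congr rfl fun i _ =>
    mgf_congr_of_identDistrib _ _ (hid i) t, Finset.prod_const, Finset.card_range] at h
  simp only [Finset.sum_apply] at h
  refine h.trans ?_
  rw [Real.exp_add]
  refine mul_le_mul_of_nonneg_left ((pow_le_pow_left₀ mgf_nonneg hmgf n).trans (le_of_eq ?_))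
    (Real.exp_nonneg _)
  rw [← Real.exp_nat_mul]
  congr 1
  ring

/-- Taking `exp (-2t)` equal to the variance `v` in the Chernoff bound, the exponent is at most
`-4Kt + 2Kt + 2`, that is, `2 + K log v`. For `v ≥ 1` the bound is trivial. -/
theorem measureReal_sum_ge_le_pow [IsProbabilityMeasure μ] {B : ℕ → Ω → ℝ}
    (hB : ∀ i, Measurable (B i)) (hind : iIndepFun B μ)
    (hid : ∀ i, IdentDistrib (B i) (B 0) μ μ) (hb : ∀ i ω, |B i ω| ≤ 1) (n K : ℕ)
    (hmean : n * ∫ ω, B 0 ω ∂μ ≤ 2 * K) :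
    μ.real {ω | 4 * (K : ℝ) ≤ ∑ i ∈ Finset.range n, B i ω} ≤
      Real.exp 2 * (n * ∫ ω, B 0 ω ^ 2 ∂μ) ^ K := by
  set v := n * ∫ ω, B 0 ω ^ 2 ∂μ with hv
  have hv0 : 0 ≤ v := mul_nonneg (Nat.cast_nonneg n) (integral_nonneg fun ω => sq_nonneg _)
  rcases le_or_gt 1 v with hv1 | hv1
  · calc μ.real {ω | 4 * (K : ℝ) ≤ ∑ i ∈ Finset.range n, B i ω} ≤ 1 := measureReal_le_one
      _ ≤ Real.exp 2 * v ^ K :=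
        one_le_mul_of_one_le_of_one_le (Real.one_le_exp zero_le_two) (one_le_pow₀ hv1)
  -- As `v` may vanish, its logarithm is avoided: use `w` slightly above `v`, then let `w` decrease
  -- to `v`.
  have key : ∀ w, v < w → w < 1 →
      μ.real {ω | 4 * (K : ℝ) ≤ ∑ i ∈ Finset.range n, B i ω} ≤ Real.exp 2 * w ^ K := by
    intro w hw hw1
    have hw0 : 0 < w := hv0.trans_lt hw
    set t := -Real.log w / 2 with ht
    have ht0 : 0 ≤ t := by
      have := Real.log_nonpos hw0.le hw1.le
      rw [ht]
      linarith
    have hwt : w = Real.exp (-(2 * t)) := by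
      rw [ht, mul_div_cancel₀ _ (two_ne_zero' ℝ), neg_neg, Real.exp_log hw0]
    refine (measureReal_sum_ge_le_exp hB hind hid hb n _ ht0).trans ?_
    rw [hwt, ← Real.exp_nat_mul, ← Real.exp_add, Real.exp_le_exp, ← hv]
    have h1 : t * (n * ∫ ω, B 0 ω ∂μ) ≤ t * (2 * K) := by gcongr
    have h2 : t ^ 2 * Real.exp t * v ≤ 2 := by
      calc t ^ 2 * Real.exp t * v ≤ t ^ 2 * Real.exp t * Real.exp (-(2 * t)) := by
            rw [← hwt]
            gcongr
        _ = t ^ 2 * Real.exp (-t) := by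
            rw [mul_assoc, ← Real.exp_add]
            ring_nf
        _ ≤ (2 * Real.exp t) * Real.exp (-t) := by
            gcongr
            linarith [Real.quadratic_le_exp_of_nonneg ht0]
        _ = 2 := by rw [mul_assoc, ← Real.exp_add, add_neg_cancel, Real.exp_zero, mul_one]
    nlinarith
  have hlim : Tendsto (fun w : ℝ => Real.exp 2 * w ^ K) (nhdsWithin v (Ioi v))
      (nhds (Real.exp 2 * v ^ K)) :=
    ((continuous_const.mul (continuous_pow K)).tendsto v).mono_left nhdsWithin_le_nhds
  refine ge_of_tendsto hlim ?_
  filter_upwards [Ioo_mem_nhdsGT hv1] with w hw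
  exact key w hw.1 hw.2

end Chernoff

/-! ### Convergence of the deviation series -/

section Deviations

variable {Ω : Type*} [MeasurableSpace Ω] {μ : Measure Ω}

theorem IsIID.comp {X : ℕ → Ω → ℝ} (hX : IsIID μ X) {g : ℝ → ℝ} (hg : Measurable g) :
    IsIID μ fun n ω => g (X n ω) where
  measurable n := hg.comp (hX.measurable n)
  indep := hX.indep.comp (fun _ => g) fun _ => hg
  ident n := (hX.ident n).comp hg

/-- Dividing by `n` makes the summands bounded by 1, with total variance proxy at most `E[|Z|
(|Z|/n); |Z| ≤ n]`; its `K`-th power is handled by `lintegral_mul_pow_le`. -/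
theorem measure_truncated_sum_ge_le [IsProbabilityMeasure μ] {Z : ℕ → Ω → ℝ} (hZ : IsIID μ Z)
    {K n : ℕ} (hK : 1 ≤ K) (hn : 0 < n) (hmean : ∫ ω, truncation (Z 0) n ω ∂μ ≤ 2 * K) :
    μ {ω | 4 * (K : ℝ) ≤ ∑ i ∈ Finset.range n, truncation (Z i) n ω / n} ≤
      ENNReal.ofReal (Real.exp 2) * ((∫⁻ ω, ENNReal.ofReal |Z 0 ω| ∂μ) ^ (K - 1) *
        ∫⁻ ω, (if |Z 0 ω| ≤ n then ENNReal.ofReal (|Z 0 ω| * (|Z 0 ω| / n) ^ K) else 0) ∂μ) := by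
  have hn0 : (0 : ℝ) < n := Nat.cast_pos.2 hn
  have hB : IsIID μ fun i ω => truncation (Z i) n ω / n :=
    hZ.comp (g := fun y => (Ioc (-(n : ℝ)) n).indicator id y / n)
      ((measurable_id.indicator measurableSet_Ioc).div_const _)
  have hb : ∀ i ω, |truncation (Z i) n ω / n| ≤ 1 := fun i ω => by
    rw [abs_div, abs_of_pos hn0, div_le_one hn0]
    exact (abs_truncation_le_bound _ _ _).trans (abs_of_pos hn0).le
  have hmean' : n * ∫ ω, truncation (Z 0) n ω / n ∂μ ≤ 2 * K := by
    rwa [integral_div, mul_div_cancel₀ _ hn0.ne']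
  have h := measureReal_sum_ge_le_pow hB.measurable hB.indep hB.ident hb n K hmean'
  have hi : Integrable (fun ω => n * (truncation (Z 0) n ω / n) ^ 2) μ :=
    (Integrable.of_bound ((hB.measurable 0).pow_const 2).aestronglyMeasurable 1
      (ae_of_all _ fun ω => by
        rw [Real.norm_eq_abs, abs_pow]
        exact pow_le_one₀ (abs_nonneg _) (hb 0 ω))).const_mul _
  set g : Ω → ℝ≥0∞ := fun ω => if |Z 0 ω| ≤ n then ENNReal.ofReal (|Z 0 ω| / n) else 0 with hg
  have hZm := hZ.measurable 0
  have hgm : Measurable g := Measurable.ite (measurableSet_le hZm.abs measurable_const)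
    (by fun_prop) measurable_const
  have hv : ENNReal.ofReal (n * ∫ ω, (truncation (Z 0) n ω / n) ^ 2 ∂μ) ≤
      ∫⁻ ω, ENNReal.ofReal |Z 0 ω| * g ω ∂μ := by
    rw [← integral_const_mul, ofReal_integral_eq_lintegral_ofReal hi
      (ae_of_all _ fun ω => by positivity)]
    refine lintegral_mono fun ω => ?_
    simp only [hg]
    split_ifs with h1
    · rw [← ENNReal.ofReal_mul (abs_nonneg _)]
      refine ENNReal.ofReal_le_ofReal ?_
      have h2 : truncation (Z 0) n ω ^ 2 ≤ |Z 0 ω| ^ 2 := by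
        rw [sq_abs]
        exact sq_le_sq.2 (abs_truncation_le_abs_self _ _ _)
      calc n * (truncation (Z 0) n ω / n) ^ 2 = truncation (Z 0) n ω ^ 2 / n := by field_simp
        _ ≤ |Z 0 ω| ^ 2 / n := by gcongr
        _ = |Z 0 ω| * (|Z 0 ω| / n) := by ring
    · have h2 : truncation (Z 0) n ω = 0 := by
        rw [truncation, Function.comp_apply, indicator_of_notMem]
        exact fun h3 => h1 (abs_le.2 ⟨h3.1.le, h3.2⟩)
      simp [h2]
  rw [← ENNReal.ofReal_toReal (measure_ne_top μ _)]
  calc ENNReal.ofReal (μ.real {ω | 4 * (K : ℝ) ≤ ∑ i ∈ Finset.range n, truncation (Z i) n ω / n})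
      ≤ ENNReal.ofReal (Real.exp 2 * (n * ∫ ω, (truncation (Z 0) n ω / n) ^ 2 ∂μ) ^ K) :=
        ENNReal.ofReal_le_ofReal h
    _ = ENNReal.ofReal (Real.exp 2) *
          ENNReal.ofReal (n * ∫ ω, (truncation (Z 0) n ω / n) ^ 2 ∂μ) ^ K := by
        rw [ENNReal.ofReal_mul (Real.exp_nonneg _), ENNReal.ofReal_pow]
        exact mul_nonneg hn0.le (integral_nonneg fun ω => sq_nonneg _)
    _ ≤ ENNReal.ofReal (Real.exp 2) * (∫⁻ ω, ENNReal.ofReal |Z 0 ω| * g ω ∂μ) ^ K := by gcongr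
    _ ≤ ENNReal.ofReal (Real.exp 2) * ((∫⁻ ω, ENNReal.ofReal |Z 0 ω| ∂μ) ^ (K - 1) *
          ∫⁻ ω, ENNReal.ofReal |Z 0 ω| * g ω ^ K ∂μ) := by
        gcongr
        exact lintegral_mul_pow_le (by fun_prop) hgm hK
    _ = _ := by
        congr 3
        funext ω
        simp only [hg]
        split_ifs
        · rw [ENNReal.ofReal_mul (abs_nonneg _), ENNReal.ofReal_pow (by positivity)]
        · rw [zero_pow (by omega), mul_zero]

/-- Either some summand reaches size `n`, or truncation changes nothing. The truncated means tend to
0, hence are eventually below `2K`. -/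
theorem eventually_measure_sum_ge_le [IsProbabilityMeasure μ] {Z : ℕ → Ω → ℝ} (hZ : IsIID μ Z)
    (hint : Integrable (Z 0) μ) (h0 : ∫ ω, Z 0 ω ∂μ = 0) {K : ℕ} (hK : 1 ≤ K) :
    ∀ᶠ n : ℕ in atTop, μ {ω | 4 * (K : ℝ) * n ≤ ∑ i ∈ Finset.range n, Z i ω} ≤
      n * μ {ω | (n : ℝ) ≤ |Z 0 ω|} +
      ENNReal.ofReal (Real.exp 2) * ((∫⁻ ω, ENNReal.ofReal |Z 0 ω| ∂μ) ^ (K - 1) *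
        ∫⁻ ω, (if |Z 0 ω| ≤ n then ENNReal.ofReal (|Z 0 ω| * (|Z 0 ω| / n) ^ K) else 0) ∂μ) := by
  have ht := (tendsto_integral_truncation hint).comp tendsto_natCast_atTop_atTop
  rw [h0] at ht
  have hK0 : (0 : ℝ) < 2 * K := by positivity
  filter_upwards [ht.eventually (ge_mem_nhds hK0), eventually_gt_atTop 0] with n hmean hn
  have hn0 : (0 : ℝ) < n := Nat.cast_pos.2 hn
  calc μ {ω | 4 * (K : ℝ) * n ≤ ∑ i ∈ Finset.range n, Z i ω}
      ≤ μ ((⋃ i ∈ Finset.range n, {ω | (n : ℝ) ≤ |Z i ω|}) ∪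
          {ω | 4 * (K : ℝ) ≤ ∑ i ∈ Finset.range n, truncation (Z i) n ω / n}) := by
        refine measure_mono fun ω hω => ?_
        by_cases h : ∃ i ∈ Finset.range n, (n : ℝ) ≤ |Z i ω|
        · left
          simpa using h
        · right
          push Not at h
          change 4 * (K : ℝ) ≤ ∑ i ∈ Finset.range n, truncation (Z i) n ω / n
          rw [← Finset.sum_div, le_div_iff₀ hn0,
            Finset.sum_congr rfl fun i hi => truncation_eq_self (h i hi)]
          exact hω
    _ ≤ μ (⋃ i ∈ Finset.range n, {ω | (n : ℝ) ≤ |Z i ω|}) + _ := measure_union_le _ _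
    _ ≤ _ := by
        refine add_le_add ?_ (measure_truncated_sum_ge_le hZ hK hn hmean)
        calc μ (⋃ i ∈ Finset.range n, {ω | (n : ℝ) ≤ |Z i ω|})
            ≤ ∑ i ∈ Finset.range n, μ {ω | (n : ℝ) ≤ |Z i ω|} := measure_biUnion_finset_le _ _
          _ = ∑ i ∈ Finset.range n, μ {ω | (n : ℝ) ≤ |Z 0 ω|} :=
              Finset.sum_congr rfl fun i _ => (hZ.ident i).measure_mem_eq
                (s := {y : ℝ | (n : ℝ) ≤ |y|}) (measurableSet_le measurable_const (by fun_prop))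
          _ = n * μ {ω | (n : ℝ) ≤ |Z 0 ω|} := by
              rw [Finset.sum_const, Finset.card_range, nsmul_eq_mul]

theorem eventually_measure_abs_sum_ge_le [IsProbabilityMeasure μ] {Z : ℕ → Ω → ℝ}
    (hZ : IsIID μ Z) (hint : Integrable (Z 0) μ) (h0 : ∫ ω, Z 0 ω ∂μ = 0) {K : ℕ} (hK : 1 ≤ K) :
    ∀ᶠ n : ℕ in atTop, μ {ω | 4 * (K : ℝ) * n ≤ |∑ i ∈ Finset.range n, Z i ω|} ≤
      2 * (n * μ {ω | (n : ℝ) ≤ |Z 0 ω|} +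
      ENNReal.ofReal (Real.exp 2) * ((∫⁻ ω, ENNReal.ofReal |Z 0 ω| ∂μ) ^ (K - 1) *
        ∫⁻ ω, (if |Z 0 ω| ≤ n then
          ENNReal.ofReal (|Z 0 ω| * (|Z 0 ω| / n) ^ K) else 0) ∂μ)) := by
  have hneg := eventually_measure_sum_ge_le (hZ.comp (g := fun y => -y) measurable_neg)
    hint.neg (by rw [integral_neg, h0, neg_zero]) hK
  filter_upwards [eventually_measure_sum_ge_le hZ hint h0 hK, hneg] with n h1 h2
  simp only [abs_neg, Finset.sum_neg_distrib] at h2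
  rw [two_mul]
  refine le_trans (measure_mono fun ω hω => ?_)
    ((measure_union_le {ω | 4 * (K : ℝ) * n ≤ ∑ i ∈ Finset.range n, Z i ω}
      {ω | 4 * (K : ℝ) * n ≤ -∑ i ∈ Finset.range n, Z i ω}).trans (add_le_add h1 h2))
  exact le_abs.1 (show 4 * (K : ℝ) * n ≤ |∑ i ∈ Finset.range n, Z i ω| from hω)

variable {G : ℝ → ℝ}

theorem tsum_ennLift_mul_measure_le (hG : MonotoneOn G (Ici 0)) {Y : Ω → ℝ} (hY : Measurable Y) :
    ∑' n : ℕ, ennLift G (n + 1 : ℕ) * μ {ω | ((n + 1 : ℕ) : ℝ) ≤ |Y ω|} ≤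
      ∫⁻ ω, ENNReal.ofReal |Y ω| * ennLift G |Y ω| ∂μ := by
  have hm : ∀ n : ℕ, MeasurableSet {y : ℝ | ((n + 1 : ℕ) : ℝ) ≤ y} := fun n => measurableSet_Ici
  calc ∑' n : ℕ, ennLift G (n + 1 : ℕ) * μ {ω | ((n + 1 : ℕ) : ℝ) ≤ |Y ω|}
      = ∫⁻ ω, ∑' n : ℕ, {y : ℝ | ((n + 1 : ℕ) : ℝ) ≤ y}.indicator
          (fun _ => ennLift G (n + 1 : ℕ)) |Y ω| ∂μ := by
        rw [lintegral_tsum fun n : ℕ =>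
          (show Measurable fun ω => {y : ℝ | ((n + 1 : ℕ) : ℝ) ≤ y}.indicator
            (fun _ => ennLift G (n + 1 : ℕ)) |Y ω|
            from (measurable_const.indicator (hm n)).comp hY.abs).aemeasurable]
        refine tsum_congr fun n => ?_
        exact (lintegral_indicator_const (hY.abs (hm n)) _).symm
    _ ≤ _ := lintegral_mono fun ω => tsum_indicator_le_mul (monotone_ennLift hG) (abs_nonneg _)

theorem tsum_lintegral_truncated_moment_lt_top [IsProbabilityMeasure μ]
    (hG : MonotoneOn G (Ici 0)) {r : ℕ} {T : ℝ} (hT : 0 < T)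
    (hd : ∀ t, T ≤ t → ennLift G (2 * t) ≤ 2 ^ r * ennLift G t) {Y : Ω → ℝ} (hY : Measurable Y)
    (hint : Integrable Y μ) (h : ∫⁻ ω, ENNReal.ofReal |Y ω| * ennLift G |Y ω| ∂μ < ∞) :
    ∑' n : ℕ, (if T ≤ n then ENNReal.ofReal (n : ℝ)⁻¹ * ennLift G n * ∫⁻ ω, (if |Y ω| ≤ n then
      ENNReal.ofReal (|Y ω| * (|Y ω| / n) ^ (r + 1)) else 0) ∂μ else 0) < ∞ := by
  have hm : ∀ n : ℕ, Measurable fun ω => if max |Y ω| T ≤ n then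
      ENNReal.ofReal ((n : ℝ)⁻¹ * (|Y ω| * (|Y ω| / n) ^ (r + 1))) * ennLift G n else 0 := fun n =>
    Measurable.ite (measurableSet_le (hY.abs.max measurable_const) measurable_const)
      (by fun_prop) measurable_const
  calc _ = ∫⁻ ω, ∑' n : ℕ, (if max |Y ω| T ≤ n then
        ENNReal.ofReal ((n : ℝ)⁻¹ * (|Y ω| * (|Y ω| / n) ^ (r + 1))) * ennLift G n else 0) ∂μ := by
        rw [lintegral_tsum fun n => (hm n).aemeasurable]
        refine tsum_congr fun n => ?_
        split_ifs with h1
        · rw [← lintegral_const_mul' _ _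
            (ENNReal.mul_ne_top ENNReal.ofReal_ne_top (ennLift_ne_top _))]
          refine lintegral_congr fun ω => ?_
          simp only [max_le_iff, h1, and_true]
          split_ifs
          · rw [ENNReal.ofReal_mul (inv_nonneg.2 (Nat.cast_nonneg n))]
            ring
          · rw [mul_zero]
        · simp [h1]
    -- The value at `max |Y| T` is at most the sum of the values at `|Y|` and `T`; the second is a
    -- constant multiplying `|Y|`, which is integrable.
    _ ≤ ∫⁻ ω, ENNReal.ofReal (2 ^ (r + 1)) *
          (ENNReal.ofReal |Y ω| * ennLift G |Y ω| + ENNReal.ofReal |Y ω| * ennLift G T) ∂μ := by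
        refine lintegral_mono fun ω =>
          (tsum_truncated_moment_le (monotone_ennLift hG) hT hd (abs_nonneg (Y ω))).trans ?_
        gcongr
        rcases le_total |Y ω| T with h1 | h1
        · rw [max_eq_right h1]
          exact le_add_self
        · rw [max_eq_left h1]
          exact le_self_add
    _ = ENNReal.ofReal (2 ^ (r + 1)) * (∫⁻ ω, ENNReal.ofReal |Y ω| * ennLift G |Y ω| ∂μ +
          (∫⁻ ω, ENNReal.ofReal |Y ω| ∂μ) * ennLift G T) := by
        have hGm := (monotone_ennLift hG).measurable
        rw [lintegral_const_mul' _ _ ENNReal.ofReal_ne_top, lintegral_add_left (by fun_prop),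
          lintegral_mul_const' _ _ (ennLift_ne_top _)]
    _ < ∞ := by
        refine ENNReal.mul_lt_top ENNReal.ofReal_lt_top (ENNReal.add_lt_top.2
          ⟨h, ENNReal.mul_lt_top ?_ (ennLift_ne_top _).lt_top⟩)
        exact (hasFiniteIntegral_iff_ofReal (ae_of_all _ fun ω => abs_nonneg _)).1 hint.abs.2

/-- The tail bound with `K = r + 1`, weighted by `G(n)/n`, splits into `∑ G(n) P[|Z| ≥ n]` and a
series of truncated moments, both controlled by `E[|Z| G(|Z|)]` and `E|Z|`. -/
theorem tsum_measure_abs_sum_ge_lt_top [IsProbabilityMeasure μ]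
    (hG : MonotoneOn G (Ici 0)) {r : ℕ} {T : ℝ} (hT : 0 < T)
    (hd : ∀ t, T ≤ t → ennLift G (2 * t) ≤ 2 ^ r * ennLift G t) {Z : ℕ → Ω → ℝ}
    (hZ : IsIID μ Z) (hint : Integrable (Z 0) μ) (h0 : ∫ ω, Z 0 ω ∂μ = 0)
    (h : ∫⁻ ω, ENNReal.ofReal |Z 0 ω| * ennLift G |Z 0 ω| ∂μ < ∞) :
    ∑' n : ℕ, ENNReal.ofReal ((n + 1 : ℕ) : ℝ)⁻¹ * ennLift G (n + 1 : ℕ) *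
      μ {ω | 4 * ((r + 1 : ℕ) : ℝ) * (n + 1 : ℕ) ≤ |∑ i ∈ Finset.range (n + 1), Z i ω|} < ∞ := by
  set w : ℕ → ℝ≥0∞ := fun n => ENNReal.ofReal (n : ℝ)⁻¹ * ennLift G n with hw
  have hwfin : ∀ n, w n ≠ ∞ := fun n =>
    ENNReal.mul_ne_top ENNReal.ofReal_ne_top (ennLift_ne_top _)
  have h1 := tsum_ennLift_mul_measure_le (μ := μ) hG (hZ.measurable 0)
  have h2 := tsum_lintegral_truncated_moment_lt_top hG hT hd (hZ.measurable 0) hint h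
  set V : ℕ → ℝ≥0∞ := fun n => if T ≤ n then w n * ∫⁻ ω, (if |Z 0 ω| ≤ n then
      ENNReal.ofReal (|Z 0 ω| * (|Z 0 ω| / n) ^ (r + 1)) else 0) ∂μ else 0 with hV
  set C : ℝ≥0∞ := ENNReal.ofReal (Real.exp 2) * (∫⁻ ω, ENNReal.ofReal |Z 0 ω| ∂μ) ^ r with hC
  have hCfin : C < ∞ := ENNReal.mul_lt_top ENNReal.ofReal_lt_top (ENNReal.pow_lt_top
    ((hasFiniteIntegral_iff_ofReal (ae_of_all _ fun ω => abs_nonneg _)).1 hint.abs.2))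
  obtain ⟨M, hM⟩ := eventually_atTop.1
    ((eventually_measure_abs_sum_ge_le hZ hint h0 (Nat.le_add_left 1 r)).and
      (tendsto_natCast_atTop_atTop.eventually_ge_atTop T))
  refine ENNReal.tsum_lt_top_of_tail M
    (fun n => ENNReal.mul_ne_top (hwfin (n + 1)) (measure_ne_top μ _)) ?_
  set U : ℕ → ℝ≥0∞ := fun n =>
    ennLift G (n + 1 : ℕ) * μ {ω | ((n + 1 : ℕ) : ℝ) ≤ |Z 0 ω|} with hU
  calc _ ≤ ∑' n : ℕ, 2 * (U (n + M) + C * V (n + M + 1)) := by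
        refine ENNReal.tsum_le_tsum fun n => ?_
        obtain ⟨h3, h4⟩ := hM (n + M + 1) (by omega)
        refine (mul_le_mul_right h3 (w (n + M + 1))).trans (le_of_eq ?_)
        have h5 : ((n + M + 1 : ℕ) : ℝ≥0∞) * w (n + M + 1) = ennLift G (n + M + 1 : ℕ) := by
          have : (0 : ℝ) < ((n + M + 1 : ℕ) : ℝ) := Nat.cast_pos.2 (Nat.succ_pos _)
          rw [hw, ← ENNReal.ofReal_natCast, ← mul_assoc, ← ENNReal.ofReal_mul this.le,
            mul_inv_cancel₀ this.ne', ENNReal.ofReal_one, one_mul]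
        simp only [hU, hV, hC, if_pos h4, Nat.add_sub_cancel, ← h5]
        ring
    _ = 2 * (∑' n, U (n + M) + C * ∑' n, V (n + M + 1)) := by
        rw [ENNReal.tsum_mul_left, ENNReal.tsum_add, ENNReal.tsum_mul_left]
    _ ≤ 2 * (∑' n, U n + C * ∑' n, V n) := by
        exact mul_le_mul_right (add_le_add
          (ENNReal.tsum_comp_le_tsum_of_injective (add_left_injective M) U)
          (mul_le_mul_right
            (ENNReal.tsum_comp_le_tsum_of_injective (add_left_injective (M + 1)) V) C)) 2
    _ < ∞ := ENNReal.mul_lt_top (by simp)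
        (ENNReal.add_lt_top.2 ⟨h1.trans_lt h, ENNReal.mul_lt_top hCfin h2⟩)

theorem deviationSeries_lt_top [IsProbabilityMeasure μ]
    (hG : MonotoneOn G (Ici 0)) {r : ℕ} {T : ℝ} (hT : 0 < T)
    (hd : ∀ t, T ≤ t → ennLift G (2 * t) ≤ 2 ^ r * ennLift G t) {X : ℕ → Ω → ℝ}
    (hX : IsIID μ X) (hint : Integrable (X 0) μ) (h0 : ∫ ω, X 0 ω ∂μ = 0)
    (h : ∫⁻ ω, ENNReal.ofReal |X 0 ω| * ennLift G |X 0 ω| ∂μ < ∞) {a : ℝ} (ha : 0 < a) :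
    deviationSeries μ G (cesaroMean X) a < ∞ := by
  -- This scale turns the fixed threshold `4(r + 1)` for `c X` into the threshold `a` for `X`.
  set c : ℝ := 4 * ((r + 1 : ℕ) : ℝ) / a with hc
  have hc0 : 0 < c := by positivity
  have hZ := hX.comp (measurable_const_mul c)
  have hZint : ∫⁻ ω, ENNReal.ofReal |c * X 0 ω| * ennLift G |c * X 0 ω| ∂μ < ∞ := by
    simp only [abs_mul, abs_of_pos hc0, ENNReal.ofReal_mul hc0.le, mul_assoc]
    rw [lintegral_const_mul' _ _ ENNReal.ofReal_ne_top]
    exact ENNReal.mul_lt_top ENNReal.ofReal_lt_top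
      (lintegral_mul_comp_mul_lt_top (monotone_ennLift hG) ennLift_ne_top hT hd c h)
  have key := tsum_measure_abs_sum_ge_lt_top hG hT hd hZ (hint.const_mul c)
    (by rw [integral_const_mul, h0, mul_zero]) hZint
  refine lt_of_eq_of_lt (tsum_congr fun n => ?_) key
  have hn : (0 : ℝ) ≤ ((n + 1 : ℕ) : ℝ) := Nat.cast_nonneg _
  rw [ENNReal.ofReal_mul (inv_nonneg.2 hn), ennLift_of_nonneg hn]
  congr 3
  funext ω
  rw [le_abs_cesaroMean_iff (Nat.succ_pos n), ← Finset.mul_sum, abs_mul, abs_of_pos hc0, hc,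
    div_mul_eq_mul_div, le_div_iff₀ ha]
  rw [mul_right_comm, mul_assoc, mul_le_mul_iff_of_pos_left (by positivity), mul_comm]

end Deviations

/-! ### The equivalences for moderate `G` -/

section Moderate

variable {Ω : Type*} [MeasurableSpace Ω] {μ : Measure Ω} {G : ℝ → ℝ}

theorem IsModerate.exists_pow_doubling (hG : IsModerate G) :
    ∃ (r : ℕ) (T : ℝ), 0 < T ∧ ∀ t, T ≤ t → ennLift G (2 * t) ≤ 2 ^ r * ennLift G t := by
  obtain ⟨c, hc⟩ := hG.doubling
  obtain ⟨T, hT⟩ := eventually_atTop.1 hc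
  obtain ⟨r, hr⟩ := pow_unbounded_of_one_lt c (one_lt_two (α := ℝ))
  refine ⟨r, max T 1, zero_lt_one.trans_le (le_max_right _ _), fun t ht => ?_⟩
  have ht0 : 0 ≤ t := zero_le_one.trans ((le_max_right _ _).trans ht)
  rw [ennLift_of_nonneg ht0, ennLift_of_nonneg (by positivity), ← ENNReal.ofReal_ofNat,
    ← ENNReal.ofReal_pow zero_le_two, ← ENNReal.ofReal_mul (by positivity)]
  exact ENNReal.ofReal_le_ofReal ((hT t ((le_max_left _ _).trans ht)).trans
    (mul_le_mul_of_nonneg_right hr.le (hG.nonneg t ht0)))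

theorem integrable_of_lintegral_abs_mul_lt_top [IsProbabilityMeasure μ]
    (hGt : Tendsto G atTop atTop) {Y : Ω → ℝ} (hY : Measurable Y)
    (h : ∫⁻ ω, ENNReal.ofReal |Y ω| * ennLift G |Y ω| ∂μ < ∞) : Integrable Y μ := by
  obtain ⟨T, hT⟩ := eventually_atTop.1 (hGt.eventually_ge_atTop 1)
  refine ⟨hY.aestronglyMeasurable, (hasFiniteIntegral_iff_norm _).2 ?_⟩
  simp only [Real.norm_eq_abs]
  calc ∫⁻ ω, ENNReal.ofReal |Y ω| ∂μ
      ≤ ∫⁻ ω, (ENNReal.ofReal T + ENNReal.ofReal |Y ω| * ennLift G |Y ω|) ∂μ := by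
        refine lintegral_mono fun ω => ?_
        rcases le_total |Y ω| T with h1 | h1
        · exact (ENNReal.ofReal_le_ofReal h1).trans le_self_add
        · refine le_trans ?_ le_add_self
          refine le_mul_of_one_le_right' ?_
          rw [ennLift_of_nonneg (abs_nonneg _)]
          exact ENNReal.one_le_ofReal.2 (hT _ h1)
    _ = ENNReal.ofReal T + ∫⁻ ω, ENNReal.ofReal |Y ω| * ennLift G |Y ω| ∂μ := by
        rw [lintegral_add_left measurable_const, lintegral_const, measure_univ, mul_one]
    _ < ∞ := ENNReal.add_lt_top.2 ⟨ENNReal.ofReal_lt_top, h⟩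

theorem lintegral_abs_mul_ennLift_lt_top_of_gConvergesTo [IsProbabilityMeasure μ]
    (hG : MonotoneOn G (Ici 0)) (hGt : Tendsto G atTop atTop) {X : ℕ → Ω → ℝ} (hX : IsIID μ X)
    {x : ℝ} (h : GConvergesTo μ G (cesaroMean X) x) :
    ∫⁻ ω, ENNReal.ofReal |X 0 ω| * ennLift G |X 0 ω| ∂μ < ∞ := by
  simpa using lintegral_abs_mul_lt_top_of_gConvergesTo hG hGt hX h zero_le_one

theorem IsModerate.tfae [IsProbabilityMeasure μ] (hG : IsModerate G) {X : ℕ → Ω → ℝ}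
    (hX : IsIID μ X) (hint : Integrable (X 0) μ) (h0 : ∫ ω, X 0 ω ∂μ = 0) :
    List.TFAE [Integrable (fun ω => |X 0 ω| * G |X 0 ω|) μ,
      ∀ a : ℝ, 0 < a → deviationSeries μ G (cesaroMean X) a < ∞,
      GConvergesTo μ G (cesaroMean X) 0] := by
  obtain ⟨r, T, hT, hd⟩ := hG.exists_pow_doubling
  rw [integrable_abs_mul_iff hG.nonneg hG.mono (hX.measurable 0)]
  tfae_have 1 → 2 := fun h a ha => deviationSeries_lt_top hG.mono hT hd hX hint h0 h ha
  tfae_have 2 → 3 :=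
    gConvergesTo_zero_of_deviationSeries_lt_top hG.nonneg hG.mono hG.tendsto hX hint h0
  tfae_have 3 → 1 := lintegral_abs_mul_ennLift_lt_top_of_gConvergesTo hG.mono hG.tendsto hX
  tfae_finish

theorem lastTime_congr {Ω : Type*} {Y Y' : ℕ → Ω → ℝ} {x x' a : ℝ} {ω : Ω}
    (h : ∀ n, 1 ≤ n → Y n ω - x = Y' n ω - x') : lastTime Y x a ω = lastTime Y' x' a ω := by
  have : {n : ℕ | 1 ≤ n ∧ a ≤ |Y n ω - x|} = {n : ℕ | 1 ≤ n ∧ a ≤ |Y' n ω - x'|} := by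
    ext n
    exact and_congr_right fun hn => by rw [h n hn]
  rw [lastTime, lastTime, this]

theorem cesaroMean_sub_const {Ω : Type*} {X : ℕ → Ω → ℝ} {x : ℝ} {n : ℕ} (hn : 1 ≤ n) (ω : Ω) :
    cesaroMean (fun i ω => X i ω - x) n ω = cesaroMean X n ω - x := by
  have : (n : ℝ) ≠ 0 := Nat.cast_ne_zero.2 (by omega)
  rw [cesaroMean, cesaroMean, Finset.sum_sub_distrib, Finset.sum_const, Finset.card_range,
    nsmul_eq_mul, sub_div, mul_div_cancel_left₀ _ this]

theorem IsModerate.exists_gConvergesTo_iff [IsProbabilityMeasure μ] (hG : IsModerate G)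
    {X : ℕ → Ω → ℝ} (hX : IsIID μ X) :
    (∃ x : ℝ, GConvergesTo μ G (cesaroMean X) x) ↔
      Integrable (fun ω => |X 0 ω| * G |X 0 ω|) μ := by
  have hXm := hX.measurable 0
  constructor
  · rintro ⟨x, hx⟩
    rw [integrable_abs_mul_iff hG.nonneg hG.mono hXm]
    exact lintegral_abs_mul_ennLift_lt_top_of_gConvergesTo hG.mono hG.tendsto hX hx
  · intro h
    rw [integrable_abs_mul_iff hG.nonneg hG.mono hXm] at h
    obtain ⟨r, T, hT, hd⟩ := hG.exists_pow_doubling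
    have hint := integrable_of_lintegral_abs_mul_lt_top hG.tendsto hXm h
    set x := ∫ ω, X 0 ω ∂μ with hx
    have hZ : IsIID μ fun i ω => X i ω - x := hX.comp (measurable_id.sub_const x)
    have hZ0 : ∫ ω, (X 0 ω - x) ∂μ = 0 := by
      rw [integral_sub hint (integrable_const x), integral_const, ← hx]
      simp
    -- Passing from `X` to `X - x` loses a factor 2 inside `G`, so that factor is first gained from
    -- doubling.
    have h2 := lintegral_mul_comp_mul_lt_top (monotone_ennLift hG.mono) ennLift_ne_top hT hd 2 h
    have h3 := lintegral_abs_mul_lt_top_of_sub (monotone_ennLift hG.mono) ennLift_ne_top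
      (Y := fun ω => X 0 ω - x) (x := -x) (b := 1) (μ := μ) zero_le_one (by simpa using h2)
    simp only [one_mul] at h3
    have h4 := ((hG.tfae hZ (hint.sub (integrable_const x)) hZ0).out 0 2).1
      ((integrable_abs_mul_iff hG.nonneg hG.mono (hZ.measurable 0)).2 h3)
    refine ⟨x, fun a ha => ?_⟩
    convert h4 a ha using 4 with ω
    refine lastTime_congr fun n hn => ?_
    rw [cesaroMean_sub_const hn, sub_zero]

end Moderate

/-! ### Counterexamples for non-moderate `G` -/

section NonModerate

variable {G : ℝ → ℝ}

theorem tendsto_atTop_of_not_bddAbove (hG : MonotoneOn G (Ici 0))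
    (hb : ¬ BddAbove (G '' Ici 0)) : Tendsto G atTop atTop := by
  refine tendsto_atTop.2 fun C => ?_
  obtain ⟨_, ⟨t, ht, rfl⟩, hC⟩ := not_bddAbove_iff.1 hb C
  filter_upwards [eventually_ge_atTop t] with s hs
  exact hC.le.trans (hG ht (mem_Ici.2 (le_trans (mem_Ici.1 ht) hs)) hs)

/-- The symmetric discrete measure with mass `q j` at each of the points `t j` and `-t j`. -/
noncomputable def symmetricSum (q : ℕ → ℝ≥0∞) (t : ℕ → ℝ) : Measure ℝ :=
  Measure.sum fun j => q j • (Measure.dirac (t j) + Measure.dirac (-t j))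

variable {q : ℕ → ℝ≥0∞} {t : ℕ → ℝ}

theorem lintegral_abs_symmetricSum (f : ℝ → ℝ≥0∞) :
    ∫⁻ x, f |x| ∂symmetricSum q t = 2 * ∑' j, q j * f |t j| := by
  rw [symmetricSum, lintegral_sum_measure, ← ENNReal.tsum_mul_left]
  refine tsum_congr fun j => ?_
  rw [lintegral_smul_measure, lintegral_add_measure, lintegral_dirac, lintegral_dirac, abs_neg,
    smul_eq_mul]
  ring

theorem integral_symmetricSum (h : Integrable (fun x : ℝ => x) (symmetricSum q t)) :
    ∫ x, x ∂symmetricSum q t = 0 := by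
  rw [symmetricSum, integral_sum_measure h]
  refine (tsum_congr fun j => ?_).trans tsum_zero
  rw [integral_smul_measure, integral_add_measure (integrable_dirac (by simp))
    (integrable_dirac (by simp)), integral_dirac, integral_dirac, add_neg_cancel, smul_zero]

theorem exists_isIID_of_law (ν : Measure ℝ) [IsProbabilityMeasure ν] :
    ∃ (Ω : Type) (_ : MeasurableSpace Ω) (μ : Measure Ω) (_ : IsProbabilityMeasure μ)
      (X : ℕ → Ω → ℝ), IsIID μ X ∧ MeasurePreserving (X 0) μ ν := by
  have hp := measurePreserving_eval_infinitePi fun _ : ℕ => ν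
  refine ⟨ℕ → ℝ, inferInstance, Measure.infinitePi fun _ => ν, inferInstance,
    fun n ω => ω n, ⟨fun n => measurable_pi_apply n, ?_, fun n => ?_⟩, hp 0⟩
  · exact iIndepFun_infinitePi (X := fun _ => id) fun _ => measurable_id
  · exact ⟨(measurable_pi_apply n).aemeasurable, (measurable_pi_apply 0).aemeasurable,
      (hp n).map_eq.trans (hp 0).map_eq.symm⟩

theorem exists_seq_of_not_isModerate (hG0 : ∀ t, 0 ≤ t → 0 ≤ G t) (hG : MonotoneOn G (Ici 0))
    (hGt : Tendsto G atTop atTop) (hm : ¬ IsModerate G) :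
    ∃ t : ℕ → ℝ, ∀ j, 1 ≤ t j ∧ 1 ≤ G (t j) ∧ 4 ^ j * G (t j) ≤ G (2 * t j) := by
  have hd : ∀ c : ℝ, ∃ᶠ t in atTop, c * G t ≤ G (2 * t) := by
    intro c hc
    refine hm ⟨hG0, hG, hGt, c, hc.mono fun t ht => (not_le.1 ht).le⟩
  have h : ∀ j : ℕ, ∃ t : ℝ, 1 ≤ t ∧ 1 ≤ G t ∧ 4 ^ j * G t ≤ G (2 * t) := fun j => by
    obtain ⟨t, h1, h2, h3⟩ := ((hd (4 ^ j)).and_eventually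
      ((eventually_ge_atTop 1).and (hGt.eventually_ge_atTop 1))).exists
    exact ⟨t, h2, h3, h1⟩
  exact ⟨fun j => (h j).choose, fun j => (h j).choose_spec⟩

/-- Masses are placed at points where `G (2 t j) ≥ 4 ^ j * G (t j)`, then normalized. Symmetry
centers the law. -/
theorem exists_law_of_not_isModerate (hG0 : ∀ t, 0 ≤ t → 0 ≤ G t) (hG : MonotoneOn G (Ici 0))
    (hGt : Tendsto G atTop atTop) (hm : ¬ IsModerate G) :
    ∃ ν : Measure ℝ, IsProbabilityMeasure ν ∧
      ∫⁻ x, ENNReal.ofReal |x| * ennLift G |x| ∂ν < ∞ ∧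
      ∫⁻ x, ENNReal.ofReal |x| * ennLift G (2 * |x|) ∂ν = ∞ ∧ ∫ x, x ∂ν = 0 := by
  obtain ⟨t, ht⟩ := exists_seq_of_not_isModerate hG0 hG hGt hm
  have ht1 : ∀ j, 1 ≤ t j := fun j => (ht j).1
  have ht0 : ∀ j, 0 < t j := fun j => zero_lt_one.trans_le (ht1 j)
  have hGt1 : ∀ j, 1 ≤ G (t j) := fun j => (ht j).2.1
  have hGt0 : ∀ j, 0 < G (t j) := fun j => zero_lt_one.trans_le (hGt1 j)
  -- These masses make the series for `|x| G(|x|)` geometric of ratio `1/2`, while the factor `4 ^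
  -- j` makes every term for `|x| G(2|x|)` at least 1. Since `t j` and `G (t j)` are at least 1, the
  -- total mass is finite.
  set q : ℕ → ℝ≥0∞ := fun j => ENNReal.ofReal ((2 ^ j * (t j * G (t j)))⁻¹) with hq
  set m := symmetricSum q t with hm'
  have hgeom : ∑' j : ℕ, ENNReal.ofReal ((2 ^ j)⁻¹ : ℝ) < ∞ := by
    have : Summable fun j : ℕ => ((2 ^ j)⁻¹ : ℝ) := by
      simpa using summable_geometric_two
    exact this.tsum_ofReal_lt_top
  have hfin : ∫⁻ x, ENNReal.ofReal |x| * ennLift G |x| ∂m < ∞ := by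
    rw [hm', lintegral_abs_symmetricSum fun y => ENNReal.ofReal y * ennLift G y]
    refine ENNReal.mul_lt_top (by simp) (lt_of_eq_of_lt (tsum_congr fun j => ?_) hgeom)
    have h1 := ht0 j
    have h2 := hGt0 j
    rw [abs_of_pos h1, ennLift_of_nonneg h1.le, ← ENNReal.ofReal_mul h1.le, hq,
      ← ENNReal.ofReal_mul (by positivity)]
    congr 1
    field_simp
  have hinf : ∫⁻ x, ENNReal.ofReal |x| * ennLift G (2 * |x|) ∂m = ∞ := by
    rw [hm', lintegral_abs_symmetricSum fun y => ENNReal.ofReal y * ennLift G (2 * y)]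
    have : ∑' j, q j * (ENNReal.ofReal |t j| * ennLift G (2 * |t j|)) = ∞ := by
      refine top_le_iff.1 ?_
      rw [← ENNReal.tsum_const_eq_top_of_ne_zero (α := ℕ) one_ne_zero]
      refine ENNReal.tsum_le_tsum fun j => ?_
      have h1 := ht0 j
      have h2 := hGt0 j
      rw [abs_of_pos h1, ennLift_of_nonneg (by positivity), ← ENNReal.ofReal_mul h1.le, hq,
        ← ENNReal.ofReal_mul (by positivity), ENNReal.one_le_ofReal, inv_mul_eq_div,
        one_le_div (by positivity)]
      calc 2 ^ j * (t j * G (t j)) ≤ 4 ^ j * (t j * G (t j)) := by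
            gcongr
            norm_num
        _ = t j * (4 ^ j * G (t j)) := by ring
        _ ≤ t j * G (2 * t j) := by
            gcongr
            exact (ht j).2.2
    rw [this]
    simp
  have huniv : m univ = 2 * ∑' j, q j := by
    rw [← setLIntegral_one, Measure.restrict_univ, hm', lintegral_abs_symmetricSum fun _ => 1]
    simp
  have hm_top : m univ ≠ ∞ := by
    rw [huniv]
    refine (ENNReal.mul_lt_top (by simp) (lt_of_le_of_lt (ENNReal.tsum_le_tsum fun j => ?_)
      hgeom)).ne
    refine ENNReal.ofReal_le_ofReal ?_
    gcongr
    exact le_mul_of_one_le_right (by positivity)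
      (one_le_mul_of_one_le_of_one_le (ht1 j) (hGt1 j))
  have hm_zero : m univ ≠ 0 := by
    rw [huniv]
    refine mul_ne_zero two_ne_zero fun h => ?_
    have h1 := ENNReal.tsum_eq_zero.1 h 0
    have h2 := ht0 0
    have h3 := hGt0 0
    exact absurd (ENNReal.ofReal_eq_zero.1 h1) (not_le.2 (by positivity))
  have hprob : IsProbabilityMeasure ((m univ)⁻¹ • m) :=
    ⟨by rw [Measure.smul_apply, smul_eq_mul, ENNReal.inv_mul_cancel hm_zero hm_top]⟩
  have hfin' : ∫⁻ x, ENNReal.ofReal |x| * ennLift G |x| ∂((m univ)⁻¹ • m) < ∞ := by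
    rw [lintegral_smul_measure]
    exact ENNReal.mul_lt_top (ENNReal.inv_lt_top.2 (pos_iff_ne_zero.2 hm_zero)) hfin
  refine ⟨(m univ)⁻¹ • m, hprob, hfin', ?_, ?_⟩
  · rw [lintegral_smul_measure, hinf, smul_eq_mul, ENNReal.mul_top (ENNReal.inv_ne_zero.2 hm_top)]
  · have h1 : Integrable id ((m univ)⁻¹ • m) :=
      integrable_of_lintegral_abs_mul_lt_top hGt measurable_id hfin'
    rw [integral_smul_measure, integral_symmetricSum ((integrable_smul_measure
      (ENNReal.inv_ne_zero.2 hm_top) (ENNReal.inv_ne_top.2 hm_zero)).1 h1), smul_zero]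

theorem exists_isIID_of_not_isModerate (hG0 : ∀ t, 0 ≤ t → 0 ≤ G t) (hG : MonotoneOn G (Ici 0))
    (hb : ¬ BddAbove (G '' Ici 0)) (hm : ¬ IsModerate G) :
    ∃ (Ω : Type) (_ : MeasurableSpace Ω) (μ : Measure Ω) (_ : IsProbabilityMeasure μ)
      (X : ℕ → Ω → ℝ), IsIID μ X ∧ Integrable (X 0) μ ∧ ∫ ω, X 0 ω ∂μ = 0 ∧
        Integrable (fun ω => |X 0 ω| * G |X 0 ω|) μ ∧ ¬ GConvergesTo μ G (cesaroMean X) 0 := by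
  have hGt := tendsto_atTop_of_not_bddAbove hG hb
  have hGm := (monotone_ennLift hG).measurable
  obtain ⟨ν, hν, h1, h2, h3⟩ := exists_law_of_not_isModerate hG0 hG hGt hm
  obtain ⟨Ω, mΩ, μ, hμ, X, hX, hp⟩ := exists_isIID_of_law ν
  have hXm := hX.measurable 0
  rw [← hp.lintegral_comp (by fun_prop)] at h1 h2
  refine ⟨Ω, mΩ, μ, hμ, X, hX, integrable_of_lintegral_abs_mul_lt_top hGt hXm h1, ?_,
    (integrable_abs_mul_iff hG0 hG hXm).2 h1, fun h => ?_⟩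
  · rw [← h3, ← hp.map_eq]
    exact (integral_map hXm.aemeasurable (f := fun x : ℝ => x) aestronglyMeasurable_id).symm
  · exact (lintegral_abs_mul_lt_top_of_gConvergesTo hG hGt hX h zero_le_two).ne h2

end NonModerate

theorem theorem1 :
    (∀ G : ℝ → ℝ, IsModerate G →
      ∀ (Ω : Type*) [MeasurableSpace Ω] (μ : Measure Ω) [IsProbabilityMeasure μ]
        (X : ℕ → Ω → ℝ), IsIID μ X →
        ((∃ x : ℝ, GConvergesTo μ G (cesaroMean X) x) ↔
          Integrable (fun ω => |X 0 ω| * G |X 0 ω|) μ) ∧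
        (Integrable (X 0) μ → ∫ ω, X 0 ω ∂μ = 0 →
          List.TFAE [
            Integrable (fun ω => |X 0 ω| * G |X 0 ω|) μ,
            ∀ a : ℝ, 0 < a → deviationSeries μ G (cesaroMean X) a < ∞,
            GConvergesTo μ G (cesaroMean X) 0])) ∧
    (∀ G : ℝ → ℝ, (∀ t, 0 ≤ t → 0 ≤ G t) → MonotoneOn G (Ici 0) → ¬ BddAbove (G '' Ici 0) →
      ¬ IsModerate G →
      ∃ (Ω : Type) (_ : MeasurableSpace Ω) (μ : Measure Ω) (_ : IsProbabilityMeasure μ)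
        (X : ℕ → Ω → ℝ), IsIID μ X ∧ Integrable (X 0) μ ∧ ∫ ω, X 0 ω ∂μ = 0 ∧
          ¬ (Integrable (fun ω => |X 0 ω| * G |X 0 ω|) μ ↔
            GConvergesTo μ G (cesaroMean X) 0)) := by
  refine ⟨fun G hG Ω _ μ _ X hX => ⟨hG.exists_gConvergesTo_iff hX,
    fun hint h0 => hG.tfae hX hint h0⟩, fun G hG0 hG hb hm => ?_⟩
  obtain ⟨Ω, mΩ, μ, hμ, X, hX, hint, h0, h1, h2⟩ :=
    exists_isIID_of_not_isModerate hG0 hG hb hm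
  exact ⟨Ω, mΩ, μ, hμ, X, hX, hint, h0, fun h => h2 (h.1 h1)⟩
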